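/- **Setting.** $N$ agents are the vertices of an undirected graph $G$ on $[N]$. Let $\mathcal N_j$ be the closed neighborhood of $j$, $N_j=|\mathcal N_j|$, and let $\mathcal X$ be the closed Euclidean unit ball of $\mathbb R^d$. At each round $t=1,\dots,T$ ($T\ge 1$) an agent $i_t$ is activated; $i_1,\dots,i_T$ are i.i.d. with $\mathbb P(i_t=i)=q_i$, where $q_i>0$ and $\sum_i q_i=1$; put $q_{\min}=\min_i q_i$. Agent $i_t$ predicts $x_t$, incurs the loss $\ell_t(x_t)$ and observes a subgradient $g_t\in\partial \ell_t(x_t)$ with $\|g_t\|_2\le 1$. The losses are convex on $\mathcal X$ and fixed in advance; $\ell_t=\ell_{t,i_t}$ may depend on the active agent. The choice of the subgradient may depend in any way on the activations. For $U=(U_1,\dots,U_N)\in\mathcal X^N$ the multitask regret is $R_T(U)=\sum_{t=1}^T\big(\ell_t(x_t)-\ell_t(U_{i_t})\big)$, and $$\sigma_j^2=\frac{1}{2N_j(N_j-1)}\sum_{i,i'\in\mathcal N_j}\|U_i-U_{i'}\|_2^2\qquad(\sigma_j^2=0\text{ if }N_j=1).$$ **Base algorithm MT-FTRL** on a clique of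 $n$ tasks, with learning rates $\beta_{t-1}$: let $A=(1+n)I-\mathbf 1\mathbf 1^\top$ and, for $X\in\mathcal X^n$ with rows $X_i$ and mean row $\bar X$, let $\sigma^2(X)=\frac1{n-1}\sum_i\|X_i-\bar X\|_2^2$ (and $0$ if $n=1$). For each $\xi\in\Xi=\{1/n,2/n,\dots,1\}$ let $\eta^{(\xi)}_{t-1}=\frac{n}{\beta_{t-1}}\sqrt{1+\xi(n-1)}$ and $$X_t^{(\xi)}=\operatorname*{argmin}_{X\in\mathcal X^n,\ \sigma^2(X)\le\xi}\ \eta_{t-1}^{(\xi)}\Big\langle\sum_{s<t}G_s,X\Big\rangle+\tfrac12\|X\|_A^2,$$ where $G_s$ is zero except for its row of index the task $i_s$ active at round $s$, which is the gradient $g_s$ received at round $s$. The output is $X_t=\sum_\xi p_t^{(\xi)}X_t^{(\xi)}$ with $p_t^{(\xi)}\propto\exp\big(-\frac{\sqrt{\ln n}}{\beta_{t-1}}\sum_{s<t}\langle g_s,[X^{(\xi)}_s]_{i_s}\rangle\big)$. (If $\beta_{t-1}=0$ the two quotients by $\beta_{t-1}$ are read as $0$.) Two versions are considered: the *capped* one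 just described, and the *uncapped* one, in which the constraint $\sigma^2(X)\le\xi$ is dropped for the top expert $\xi=1$ only. **Two-phase strategy.** Let $w_{ij}\ge0$ with $\sum_{j\in\mathcal N_i}w_{ij}=1$ for all $i$. The active agent predicts $x_t=\sum_{j\in\mathcal N_{i_t}}w_{i_tj}[Y^{(j)}_t]_{i_t}$ and sends $w_{i_tj}g_t$ to every $j\in\mathcal N_{i_t}$. The models $Y^{(j)}_t$ of agent $j$ (one row for each task in $\mathcal N_j$) are computed from the rounds with $i_s\in\mathcal N_j$; the number of those rounds is the local time of $j$. First, $Y_t^{(j)}=0$ until the local time reaches $\tau=\big\lceil\frac4{q_{\min}}\ln(2N^2T)\big\rceil$. Let $\hat\pi_{ij}(\tau)$ be the fraction of these first $\tau$ local rounds in which $i$ was active. Then $Y_t^{(j)}$ is the output of a fresh MT-FTRL on the tasks $\mathcal N_j$, fed with the gradients $w_{i_sj}g_s$ of the later local rounds, with $$\beta_{t-1}=\sqrt{\sum_{i\in\mathcal N_j}\hat\pi_{ij}(\tau)\,w_{ij}^2}\ \sqrt{1+\sum_{s\le t-1}\mathbb I\{i_s\in\mathcal N_j\}-\tau}.$$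 **Theorem.** There is a universal constant $C>0$ such that, for all $N,d,T,G,q,w$, all losses and subgradients as above and all $U\in\mathcal X^N$, $$\mathbb E[R_T(U)]\le C\left(\sqrt{\ln(2N)}\,\Big(\sum_{j=1}^N\sqrt{\sum_{i\in\mathcal N_j}q_iw_{ij}^2}\,\sqrt{1+\sigma_j^2(N_j-1)}\Big)\sqrt T+\ln(2N^2T)\,\frac{N}{q_{\min}}\right),$$ where the expectation is over $i_1,\dots,i_T$. This holds * for the capped version, if the losses do not depend on the active agent ($\ell_{t,i}=\ell_t$ for all $i$) or if $\sigma_j^2\le1$ for all $j$; * for the uncapped version, without any further condition. In particular, up to logarithmic factors in $N$ and $T$, the expected regret is at most $\big(\sum_j\sqrt{\sum_{i\in\mathcal N_j}q_iw_{ij}^2}\sqrt{1+\sigma_j^2(N_j-1)}\big)\sqrt T+N/q_{\min}$. -/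

import Mathlib

open MeasureTheory ProbabilityTheory

namespace MTCool

/-- The ambient space `ℝ^d` with its Euclidean norm; the decision space is its closed unit ball. -/
abbrev E (d : ℕ) : Type := EuclideanSpace ℝ (Fin d)

/-- `g` is a subgradient at `x` of `f`, seen as a function on the closed unit ball. -/
def IsSubgradientAt {d : ℕ} (f : E d → ℝ) (x g : E d) : Prop :=
  ∀ y : E d, ‖y‖ ≤ 1 → f x + inner ℝ g (y - x) ≤ f y

section Clique

/-! The base algorithm `MT-FTRL` on a clique whose set of tasks is `ι`. A matrix in `ℝ^(ι × d)` is
the family of its rows `ι → E d`. A history is the chronological list of the pairs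
`(active task, observed gradient)`. The learning rates are given by `β : ℕ → ℝ`, where `β n` is
the value used in a round that is preceded by `n` rounds. -/

variable {ι : Type*} [Fintype ι] [DecidableEq ι] {d : ℕ}

/-- The variance `(1 / (N - 1)) ∑ i, ‖X i - mean‖ ^ 2` of the rows (`0` if there is one row). -/
noncomputable def taskVariance (X : ι → E d) : ℝ :=
  1 / ((Fintype.card ι : ℝ) - 1) *
    ∑ i, ‖X i - (1 / (Fintype.card ι : ℝ)) • ∑ k, X k‖ ^ 2

/-- `A = (1 + N) I - 1 1ᵀ`. -/
def interactionMatrix (ι : Type*) [Fintype ι] [DecidableEq ι] : Matrix ι ι ℝ :=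
  (1 + (Fintype.card ι : ℝ)) • (1 : Matrix ι ι ℝ) - Matrix.of (fun _ _ => (1 : ℝ))

/-- The squared Mahalanobis norm `‖X‖_A ^ 2 = ∑ i k, A i k ⟨X i, X k⟩`. -/
noncomputable def normASq (X : ι → E d) : ℝ :=
  ∑ i, ∑ k, interactionMatrix ι i k * inner ℝ (X i) (X k)

/-- Cumulative gradient matrix: row `i` is the sum of the gradients observed for task `i`. -/
noncomputable def gradSum (L : List (ι × E d)) (i : ι) : E d :=
  (L.map fun r => if r.1 = i then r.2 else 0).sum

/-- The matrices over which the expert with parameter `ξ` minimizes: rows in the unit ball and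
variance at most `ξ`. If `capTop` holds, this is so for every expert; if `capTop` fails, the
variance constraint is dropped for the top expert `ξ = 1` (and only for it). -/
def feasible (capTop : Prop) (ξ : ℝ) : Set (ι → E d) :=
  {X | (∀ i, ‖X i‖ ≤ 1) ∧ (ξ < 1 ∨ capTop → taskVariance X ≤ ξ)}

/-- `η = (N / β) √(1 + ξ (N - 1))`. For `β = 0` (all weighted gradients seen with positive empirical
frequency are zero) this is `0`, so that the expert predicts `0`. -/
noncomputable def expertRate (ι : Type*) [Fintype ι] (b ξ : ℝ) : ℝ :=
  (Fintype.card ι : ℝ) / b * √(1 + ξ * ((Fintype.card ι : ℝ) - 1))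

/-- The function minimized by an expert: `η ⟨∑ G_s, X⟩ + ‖X‖_A ^ 2 / 2`. -/
noncomputable def ftrlObjective (η : ℝ) (L : List (ι × E d)) (X : ι → E d) : ℝ :=
  η * ∑ i, inner ℝ (gradSum L i) (X i) + 1 / 2 * normASq X

/-- The model of the expert with parameter `ξ` after the history `L`: the (unique) minimizer of
the objective over the feasible set, which is convex, compact and contains `0`. -/
noncomputable def expertModel (capTop : Prop) (β : ℕ → ℝ) (ξ : ℝ) (L : List (ι × E d)) :
    ι → E d :=
  Classical.epsilon fun X =>
    X ∈ feasible capTop ξ ∧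
      IsMinOn (ftrlObjective (expertRate ι (β L.length) ξ) L) (feasible capTop ξ) X

/-- The cumulative linearized loss of an expert over the history `L`. -/
noncomputable def expertLoss (capTop : Prop) (β : ℕ → ℝ) (ξ : ℝ) (L : List (ι × E d)) : ℝ :=
  ∑ s : Fin L.length,
    inner ℝ (L.get s).2 (expertModel capTop β ξ (L.take s) (L.get s).1)

/-- The grid `{1 / N, 2 / N, …, 1}`. -/
noncomputable def grid (ι : Type*) [Fintype ι] (k : Fin (Fintype.card ι)) : ℝ :=
  ((k : ℕ) + 1 : ℝ) / (Fintype.card ι : ℝ)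

/-- The unnormalized `Hedge` weight of an expert. -/
noncomputable def hedgeExp (capTop : Prop) (β : ℕ → ℝ) (L : List (ι × E d))
    (k : Fin (Fintype.card ι)) : ℝ :=
  Real.exp (-(√(Real.log (Fintype.card ι)) / β L.length)
    * expertLoss capTop β (grid ι k) L)

/-- The model of `MT-FTRL` after the history `L`: the `Hedge` average of the experts' models. -/
noncomputable def mtFtrl (capTop : Prop) (β : ℕ → ℝ) (L : List (ι × E d)) : ι → E d :=
  ∑ k, (hedgeExp capTop β L k / ∑ k', hedgeExp capTop β L k') •
    expertModel capTop β (grid ι k) L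

end Clique

section Network

variable {N d : ℕ} (G : SimpleGraph (Fin N)) [DecidableRel G.Adj]

/-- The closed neighborhood of `j`. -/
def nbhd (j : Fin N) : Finset (Fin N) := {i | i = j ∨ G.Adj i j}

theorem mem_nbhd_symm {i j : Fin N} (h : j ∈ nbhd G i) : i ∈ nbhd G j := by
  simp only [nbhd, Finset.mem_filter, Finset.mem_univ, true_and] at h ⊢
  exact h.imp Eq.symm fun e => e.symm

/-- The local variance `(1 / (2 N_j (N_j - 1))) ∑ ‖U i - U i'‖ ^ 2`, over `i, i'` in the closed
neighborhood of `j` (`0` if `j` is isolated). -/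
noncomputable def localVariance (U : Fin N → E d) (j : Fin N) : ℝ :=
  1 / (2 * ((nbhd G j).card : ℝ) * (((nbhd G j).card : ℝ) - 1)) *
    ∑ i ∈ nbhd G j, ∑ i' ∈ nbhd G j, ‖U i - U i'‖ ^ 2

/-- The data received by agent `j` from a global history: the rounds `s` whose active agent `i_s`
is in the closed neighborhood of `j`, with the weighted gradients `w (i_s) j • g_s`. Its length is
the local time of `j`. -/
noncomputable def localHistory (w : Fin N → Fin N → ℝ) (j : Fin N) (H : List (Fin N × E d)) :
    List (nbhd G j × E d) :=
  H.filterMap fun r => if h : r.1 ∈ nbhd G j then some (⟨r.1, h⟩, w r.1 j • r.2) else none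

/-- The empirical frequency of `i` among the first `τ` rounds of a local history. -/
noncomputable def empiricalFreq {j : Fin N} (τ : ℕ) (L : List (nbhd G j × E d))
    (i : nbhd G j) : ℝ :=
  ((L.take τ).countP (fun r => decide (r.1 = i)) : ℝ) / (τ : ℝ)

/-- The two-phase strategy of agent `j` on its virtual clique: predict `0` during the first `τ`
local rounds, then run a fresh `MT-FTRL` on the later local rounds, with learning rates
`√(∑ i, π̂_ij(τ) w_ij ^ 2) √(1 + local time - τ)`. -/
noncomputable def agentModel (capTop : Prop) (w : Fin N → Fin N → ℝ) (τ : ℕ) (j : Fin N)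
    (H : List (Fin N × E d)) : nbhd G j → E d :=
  let L := localHistory G w j H
  if L.length < τ then 0
  else
    mtFtrl capTop
      (fun n => √(∑ i : nbhd G j, empiricalFreq G τ L i * w i j ^ 2) * √(1 + (n : ℝ)))
      (L.drop τ)

/-- The prediction of the active agent `i` after the global history `H`: the weighted average of
the models fetched from its closed neighborhood. -/
noncomputable def predict (capTop : Prop) (w : Fin N → Fin N → ℝ) (τ : ℕ)
    (H : List (Fin N × E d)) (i : Fin N) : E d :=
  ∑ j : nbhd G i, w i j • agentModel G capTop w τ j H ⟨i, mem_nbhd_symm G j.2⟩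

/-- The prediction `x_t` at round `t` when the activations are `a` and the observed gradients are
`g`; it depends on `a` up to round `t` and on `g` before round `t`. -/
noncomputable def run (capTop : Prop) (w : Fin N → Fin N → ℝ) (τ : ℕ) {T : ℕ}
    (a : Fin T → Fin N) (g : Fin T → E d) (t : Fin T) : E d :=
  predict G capTop w τ ((List.ofFn fun s => (a s, g s)).take t) (a t)

/-- The multitask regret `∑ t, ℓ_t(x_t) - ℓ_t(U (i_t))` of predictions `x`, where `ℓ t i` is the
loss of round `t` if agent `i` is active in it. -/
def multitaskRegret {T : ℕ} (ℓ : Fin T → Fin N → E d → ℝ) (a : Fin T → Fin N) (x : Fin T → E d)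
    (U : Fin N → E d) : ℝ :=
  ∑ t, (ℓ t (a t) (x t) - ℓ t (a t) (U (a t)))

/-- The length `⌈(4 / q_min) ln(2 N² T)⌉` of the first phase. -/
noncomputable def burnIn {N : ℕ} (q : Fin N → ℝ) (T : ℕ) : ℕ :=
  ⌈4 / (⨅ i, q i) * Real.log (2 * (N : ℝ) ^ 2 * (T : ℝ))⌉₊

end Network

end MTCool

/-! The subgradient inequality linearizes the losses. As the weights of an agent sum to one, the
linearized regret is exactly the sum over the agents `j` of local regrets, on the rounds with active
agent in the closed neighborhood of `j` and with gradients of norm at most `w i j`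
(`pathSum_predict_eq`). The first phase costs each agent at most `τ`. The second phase is bounded
pathwise by a function of the activations alone (`second_phase_le`), so it is harmless that the
subgradients may depend on the activations in any way.

On a clique of `n` tasks, the regret is that of Hedge against one expert plus that of this expert
against the comparator (`mtFtrl_regret`). For the expert, `‖X‖_A ^ 2` dominates `n / 2` times the
square of each row, so a gradient supported on one row is cheap, while the comparator has `‖U‖_A ^
2` of order at most `n (1 + σ² (n - 1))`; some `ξ` of the grid has the same order as `σ²`, or is `1`
for a large variance when the top expert is uncapped (`exists_grid`). Both regrets are controlled by
the last rate `β` plus the sum of `‖g‖ ^ 2 / β`.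

The rate uses an empirical second moment of the weights; let `V` be the true one, conditional on an
activation in the neighborhood `S`. If the two agree within a factor 4, the expected bound is of
order `√V √(T ∑ i ∈ S, q i) = √(∑ i ∈ S, q i w i ^ 2) √T`. Otherwise only the crude bound by twice
the sum of the weights is available, but exponential supermartingales frozen after `τ` visits make
this case rare enough to be absorbed (`avg_second_phase_le`).

There remains the capped version with common losses and some local variance above one. There `U` is
replaced by the constant comparator `∑ i, q i • U i`, whose local variances vanish and which, by
Jensen's inequality, is no worse in expectation. -/

namespace MTCool

/-- The sum along a list of a quantity that depends on the elements seen before and on the current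
element. -/
noncomputable def pathSum {α : Type*} (f : List α → α → ℝ) (L : List α) : ℝ :=
  ∑ s : Fin L.length, f (L.take s) (L.get s)

/-! ### Sums along the prefixes of a history. -/

section PathSum

variable {α : Type*}

@[simp] theorem pathSum_nil (f : List α → α → ℝ) : pathSum f [] = 0 := by
  simp [pathSum]

theorem pathSum_cons (f : List α → α → ℝ) (a : α) (L : List α) :
    pathSum f (a :: L) = f [] a + pathSum (fun l => f (a :: l)) L := by
  unfold pathSum
  exact Fin.sum_univ_succ (n := L.length) _

theorem pathSum_append (f : List α → α → ℝ) (L₁ L₂ : List α) :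
    pathSum f (L₁ ++ L₂) = pathSum f L₁ + pathSum (fun l => f (L₁ ++ l)) L₂ := by
  induction L₁ generalizing f with
  | nil => simp
  | cons a L ih => rw [List.cons_append, pathSum_cons, ih, pathSum_cons]; simp [add_assoc]

theorem pathSum_concat (f : List α → α → ℝ) (L : List α) (a : α) :
    pathSum f (L ++ [a]) = pathSum f L + f L a := by
  rw [pathSum_append, pathSum_cons]; simp

theorem pathSum_mono {f g : List α → α → ℝ} {L : List α} (h : ∀ l, ∀ a ∈ L, f l a ≤ g l a) :
    pathSum f L ≤ pathSum g L :=
  Finset.sum_le_sum fun s _ => h _ _ (List.get_mem L s)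

theorem pathSum_congr {f g : List α → α → ℝ} {L : List α}
    (h : ∀ l, l.length < L.length → ∀ a ∈ L, f l a = g l a) :
    pathSum f L = pathSum g L :=
  Finset.sum_congr rfl fun s _ => h _ (by simp) _ (List.get_mem L s)

theorem pathSum_sub (f g : List α → α → ℝ) (L : List α) :
    pathSum (fun l a => f l a - g l a) L = pathSum f L - pathSum g L :=
  Finset.sum_sub_distrib _ _

theorem pathSum_const_mul (c : ℝ) (f : List α → α → ℝ) (L : List α) :
    pathSum (fun l a => c * f l a) L = c * pathSum f L :=
  (Finset.mul_sum _ _ _).symm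

theorem pathSum_nonneg {f : List α → α → ℝ} {L : List α} (h : ∀ l, ∀ a ∈ L, 0 ≤ f l a) :
    0 ≤ pathSum f L :=
  Finset.sum_nonneg fun s _ => h _ _ (List.get_mem L s)

theorem pathSum_eq_sum_map (f : α → ℝ) (L : List α) :
    pathSum (fun _ a => f a) L = (L.map f).sum := by
  induction L using List.reverseRecOn with
  | nil => simp
  | append_singleton L a ih => rw [pathSum_concat, ih]; simp

theorem pathSum_map {β : Type*} (e : α → β) (f : List β → β → ℝ) (L : List α) :
    pathSum f (L.map e) = pathSum (fun l a => f (l.map e) (e a)) L := by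
  induction L using List.reverseRecOn with
  | nil => simp
  | append_singleton L a ih => rw [List.map_append, List.map_singleton, pathSum_concat, ih,
      pathSum_concat]

end PathSum

/-! ### Exponentially weighted averages with varying learning rates. -/

section Hedge

/-- The linear term disappears under a centered average and leaves a sub-Gaussian bound. As `y` is
not required to be small, the Hedge rates need no upper bound. -/
theorem exp_le_self_add_exp_sq (y : ℝ) : Real.exp y ≤ y + Real.exp (y ^ 2) := by
  have h2 := Real.add_one_le_exp (y ^ 2)
  rcases le_or_gt |y| 1 with h | h
  · have h1 := (abs_le.1 (Real.abs_exp_sub_one_sub_id_le h)).2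
    linarith
  · rcases lt_abs.1 h with h | h
    · have : Real.exp y ≤ Real.exp (y ^ 2) := Real.exp_le_exp.2 (by nlinarith)
      linarith
    · have : Real.exp y ≤ 1 := Real.exp_le_one_iff.2 (by linarith)
      nlinarith

variable {K : Type*} [Fintype K]

/-- Center at the mean `m`: the deviations are at most `2 * b`, whence the constant 4, and their
linear terms average to zero. -/
theorem log_sum_exp_le {p x : K → ℝ} {η b : ℝ} (hp : ∀ k, 0 ≤ p k) (hp1 : ∑ k, p k = 1)
    (hx : ∀ k, |x k| ≤ b) :
    Real.log (∑ k, p k * Real.exp (-(η * x k))) ≤ -(η * ∑ k, p k * x k) + 4 * η ^ 2 * b ^ 2 := by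
  set m := ∑ k, p k * x k with hm
  have hmb : |m| ≤ b := by
    calc |m| ≤ ∑ k, |p k * x k| := Finset.abs_sum_le_sum_abs _ _
      _ ≤ ∑ k, p k * b := Finset.sum_le_sum fun k _ => by
          rw [abs_mul, abs_of_nonneg (hp k)]; exact mul_le_mul_of_nonneg_left (hx k) (hp k)
      _ = b := by rw [← Finset.sum_mul, hp1, one_mul]
  have key : ∑ k, p k * Real.exp (-(η * x k)) ≤
      Real.exp (-(η * m) + 4 * η ^ 2 * b ^ 2) := by
    have h1 : ∀ k, p k * Real.exp (-(η * x k)) ≤ Real.exp (-(η * m)) *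
        (p k * (η * (m - x k)) + p k * Real.exp (4 * η ^ 2 * b ^ 2)) := by
      intro k
      have e1 : Real.exp (-(η * x k)) = Real.exp (-(η * m)) * Real.exp (η * (m - x k)) := by
        rw [← Real.exp_add]; congr 1; ring
      have e2 : Real.exp (η * (m - x k)) ≤ η * (m - x k) + Real.exp (4 * η ^ 2 * b ^ 2) := by
        refine (exp_le_self_add_exp_sq _).trans ?_
        gcongr
        rw [mul_pow]
        have : (m - x k) ^ 2 ≤ (2 * b) ^ 2 := by
          apply sq_le_sq'
          · linarith [abs_le.1 hmb, abs_le.1 (hx k)]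
          · linarith [abs_le.1 hmb, abs_le.1 (hx k)]
        nlinarith [sq_nonneg η]
      rw [e1]
      have := mul_le_mul_of_nonneg_left e2 (mul_nonneg (hp k) (Real.exp_pos (-(η * m))).le)
      linarith
    refine (Finset.sum_le_sum fun k _ => h1 k).trans ?_
    rw [← Finset.mul_sum, Finset.sum_add_distrib, ← Finset.sum_mul, hp1]
    have : ∑ k, p k * (η * (m - x k)) = 0 := by
      have : ∀ k, p k * (η * (m - x k)) = η * m * p k - η * (p k * x k) := fun k => by ring
      simp only [this]
      rw [Finset.sum_sub_distrib, ← Finset.mul_sum, ← Finset.mul_sum, hp1, ← hm]; ring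
    rw [this, zero_add, one_mul, ← Real.exp_add]
  have hpos : 0 < ∑ k, p k * Real.exp (-(η * x k)) := by
    obtain ⟨k, hk⟩ : ∃ k, 0 < p k := by
      by_contra! h
      have : ∑ k, p k ≤ 0 := Finset.sum_nonpos fun k _ => h k
      linarith
    exact Finset.sum_pos' (fun k _ => mul_nonneg (hp k) (Real.exp_pos _).le)
      ⟨k, Finset.mem_univ _, mul_pos hk (Real.exp_pos _)⟩
  exact (Real.log_le_iff_le_exp hpos).2 key

variable [Nonempty K]

/-- The potential `-(1 / η) log (mean of exp (-η x))`. -/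
noncomputable def mixPotential (η : ℝ) (x : K → ℝ) : ℝ :=
  -(1 / η * Real.log (∑ k, 1 / (Fintype.card K : ℝ) * Real.exp (-(η * x k))))

theorem mean_exp_pos (η : ℝ) (x : K → ℝ) :
    0 < ∑ k, 1 / (Fintype.card K : ℝ) * Real.exp (-(η * x k)) := by
  have : 0 < (Fintype.card K : ℝ) := by exact_mod_cast Fintype.card_pos
  exact Finset.sum_pos (fun k _ => by positivity) Finset.univ_nonempty

/-- This is the power mean inequality with exponent `η / η' ≥ 1`. It makes every decrease of the
learning rate free of charge. -/
theorem mixPotential_antitone {η η' : ℝ} (h' : 0 < η') (h : η' ≤ η) (x : K → ℝ) :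
    mixPotential η x ≤ mixPotential η' x := by
  have hη : 0 < η := h'.trans_le h
  have hc : 0 < (Fintype.card K : ℝ) := by exact_mod_cast Fintype.card_pos
  have h1 := Real.rpow_arith_mean_le_arith_mean_rpow Finset.univ
    (fun _ : K => 1 / (Fintype.card K : ℝ)) (fun k => Real.exp (-(η' * x k)))
    (fun _ _ => by positivity) (by simp) (fun _ _ => (Real.exp_pos _).le)
    (p := η / η') ((one_le_div h').2 h)
  have h2 : ∀ k, Real.exp (-(η' * x k)) ^ (η / η') = Real.exp (-(η * x k)) := fun k => by
    rw [← Real.exp_mul]; congr 1; field_simp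
  simp only [h2] at h1
  have h3 := Real.log_le_log (Real.rpow_pos_of_pos (mean_exp_pos η' x) _) h1
  rw [Real.log_rpow (mean_exp_pos η' x)] at h3
  unfold mixPotential
  have h4 := mul_le_mul_of_nonneg_left h3 (one_div_pos.2 hη).le
  rw [← mul_assoc, one_div_mul_eq_div, div_div_cancel_left' hη.ne', ← one_div] at h4
  linarith

theorem mixPotential_le {η : ℝ} (hη : 0 < η) (x : K → ℝ) (k : K) :
    mixPotential η x ≤ x k + Real.log (Fintype.card K) / η := by
  have hc : 0 < (Fintype.card K : ℝ) := by exact_mod_cast Fintype.card_pos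
  have h1 : 1 / (Fintype.card K : ℝ) * Real.exp (-(η * x k)) ≤
      ∑ k, 1 / (Fintype.card K : ℝ) * Real.exp (-(η * x k)) :=
    Finset.single_le_sum (f := fun k => 1 / (Fintype.card K : ℝ) * Real.exp (-(η * x k)))
      (fun k _ => by positivity) (Finset.mem_univ k)
  have h2 := Real.log_le_log (by positivity) h1
  rw [Real.log_mul (by positivity) (Real.exp_pos _).ne', Real.log_exp, one_div, Real.log_inv] at h2
  have h3 := mul_le_mul_of_nonneg_left h2 (one_div_pos.2 hη).le
  unfold mixPotential
  have h4 : 1 / η * (-Real.log (Fintype.card K) + -(η * x k)) =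
      -(x k + Real.log (Fintype.card K) / η) := by field_simp; ring
  rw [h4] at h3
  simp only [one_div] at h3 ⊢
  linarith

/-- The weights of exponentially weighted averages sum to one. -/
theorem sum_softmax (y : K → ℝ) : ∑ k, Real.exp (y k) / ∑ k', Real.exp (y k') = 1 := by
  rw [← Finset.sum_div]
  exact div_self (Finset.sum_pos (fun k _ => Real.exp_pos (y k)) Finset.univ_nonempty).ne'

/-- The quotient of the new and old normalizers is the softmax average of `exp (-η y)`, to which
`log_sum_exp_le` applies. -/
theorem mixPotential_step {η b : ℝ} (hη : 0 < η) (x y : K → ℝ) (hy : ∀ k, |y k| ≤ b) :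
    mixPotential η x +
      ∑ k, Real.exp (-(η * x k)) / (∑ k', Real.exp (-(η * x k'))) * y k ≤
      mixPotential η (fun k => x k + y k) + 4 * η * b ^ 2 := by
  have hc : 0 < (Fintype.card K : ℝ) := by exact_mod_cast Fintype.card_pos
  have hS : 0 < ∑ k, Real.exp (-(η * x k)) :=
    Finset.sum_pos (fun k _ => Real.exp_pos _) Finset.univ_nonempty
  set p : K → ℝ := fun k => Real.exp (-(η * x k)) / (∑ k', Real.exp (-(η * x k'))) with hp
  have h1 := log_sum_exp_le (p := p) (x := y) (η := η) (b := b)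
    (fun k => div_nonneg (Real.exp_pos _).le hS.le) (sum_softmax fun k => -(η * x k)) hy
  have h2 : ∑ k, 1 / (Fintype.card K : ℝ) * Real.exp (-(η * (x k + y k))) =
      (∑ k, 1 / (Fintype.card K : ℝ) * Real.exp (-(η * x k))) *
        ∑ k, p k * Real.exp (-(η * y k)) := by
    have h3 : ∀ k, Real.exp (-(η * (x k + y k))) =
        (∑ k', Real.exp (-(η * x k'))) * (p k * Real.exp (-(η * y k))) := fun k => by
      rw [hp, mul_add, neg_add, Real.exp_add]
      field_simp
    simp only [h3, ← Finset.mul_sum, mul_assoc]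
  have hpos : 0 < ∑ k, p k * Real.exp (-(η * y k)) :=
    Finset.sum_pos (fun k _ => mul_pos (div_pos (Real.exp_pos (-(η * x k))) hS) (Real.exp_pos _))
      Finset.univ_nonempty
  unfold mixPotential
  rw [h2, Real.log_mul (mean_exp_pos η x).ne' hpos.ne', mul_add]
  have h3 := mul_le_mul_of_nonneg_left h1 (one_div_pos.2 hη).le
  have h4 : 1 / η * (-(η * ∑ k, p k * y k) + 4 * η ^ 2 * b ^ 2) =
      -(∑ k, p k * y k) + 4 * η * b ^ 2 := by field_simp
  rw [h4] at h3
  linarith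

/-- The regret bound of exponentially weighted averages with nonincreasing learning rates. -/
theorem hedge_regret {α : Type*} {η : ℕ → ℝ} (hη : ∀ n, 0 < η n) (hanti : Antitone η)
    (ℓ : K → List α → α → ℝ) (b : α → ℝ) (L : List α) (hb : ∀ k l, ∀ a ∈ L, |ℓ k l a| ≤ b a) (k : K) :
    pathSum (fun l a => ∑ k, Real.exp (-(η l.length * pathSum (ℓ k) l)) /
        (∑ k', Real.exp (-(η l.length * pathSum (ℓ k') l))) * ℓ k l a) L ≤
      pathSum (ℓ k) L + Real.log (Fintype.card K) / η (L.length - 1) +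
        pathSum (fun l a => 4 * η l.length * b a ^ 2) L := by
  -- The potential is taken at the rate of the last round played. Before a round is appended, it is
  -- moved to the next rate by antitonicity.
  have key : pathSum (fun l a => ∑ k, Real.exp (-(η l.length * pathSum (ℓ k) l)) /
        (∑ k', Real.exp (-(η l.length * pathSum (ℓ k') l))) * ℓ k l a) L ≤
      mixPotential (η (L.length - 1)) (fun k => pathSum (ℓ k) L) +
        pathSum (fun l a => 4 * η l.length * b a ^ 2) L := by
    clear k
    induction L using List.reverseRecOn with
    | nil => simp [mixPotential]
    | append_singleton L a ih =>
      specialize ih fun k l a' ha' => hb k l a' (by simp [ha'])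
      simp only [pathSum_concat, List.length_append, List.length_singleton, add_tsub_cancel_right]
      have h1 := mixPotential_antitone (hη L.length) (hanti (Nat.sub_le L.length 1))
        (fun k => pathSum (ℓ k) L)
      have h2 := mixPotential_step (hη L.length) (fun k => pathSum (ℓ k) L) (fun k => ℓ k L a)
        (fun k => hb k L a (by simp))
      linarith
  have := mixPotential_le (hη (L.length - 1)) (fun k => pathSum (ℓ k) L) k
  linarith

end Hedge

/-! ### The experts: geometry of the interaction norm and follow the regularized leader. -/

section Ftrl

set_option linter.unusedSectionVars false

variable {ι : Type*} [Fintype ι] [DecidableEq ι] {d : ℕ}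

theorem normASq_eq (X : ι → E d) :
    normASq X = (1 + (Fintype.card ι : ℝ)) * ∑ i, ‖X i‖ ^ 2 - ‖∑ i, X i‖ ^ 2 := by
  have h : ‖∑ i, X i‖ ^ 2 = ∑ i, ∑ k, inner ℝ (X i) (X k) := by
    rw [← real_inner_self_eq_norm_sq, sum_inner]
    simp only [inner_sum]
  rw [h, normASq, Finset.mul_sum, ← Finset.sum_sub_distrib]
  refine Finset.sum_congr rfl fun i _ => ?_
  simp only [interactionMatrix, Matrix.sub_apply, Matrix.smul_apply, Matrix.one_apply,
    Matrix.of_apply, sub_mul, smul_eq_mul, mul_ite, mul_one, mul_zero, ite_mul, zero_mul, one_mul]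
  rw [Finset.sum_sub_distrib]
  simp

theorem sum_sum_norm_sub_sq (X : ι → E d) :
    ∑ i, ∑ k, ‖X i - X k‖ ^ 2 =
      2 * ((Fintype.card ι : ℝ) * ∑ i, ‖X i‖ ^ 2 - ‖∑ i, X i‖ ^ 2) := by
  have h : ‖∑ i, X i‖ ^ 2 = ∑ i, ∑ k, inner ℝ (X i) (X k) := by
    rw [← real_inner_self_eq_norm_sq, sum_inner]
    simp only [inner_sum]
  simp only [norm_sub_sq_real, Finset.sum_add_distrib, Finset.sum_sub_distrib, ← Finset.mul_sum]
  rw [h]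
  simp only [Finset.sum_const, Finset.card_univ, nsmul_eq_mul]
  rw [← Finset.mul_sum]
  ring

/-- This form shows positivity, and that only disagreement between the rows is penalized beyond the
Euclidean norm. -/
theorem normASq_eq_add (X : ι → E d) :
    normASq X = ∑ i, ‖X i‖ ^ 2 + 1 / 2 * ∑ i, ∑ k, ‖X i - X k‖ ^ 2 := by
  rw [normASq_eq, sum_sum_norm_sub_sq]; ring

theorem normASq_nonneg (X : ι → E d) : 0 ≤ normASq X := by
  rw [normASq_eq_add]; positivity

/-- A large row `i` forces every row `k` either to be large or to differ from it: square `‖X i‖ ≤ ‖X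
k‖ + ‖X k - X i‖` and sum over `k`. This strong convexity in a single row is what makes sharing
between tasks pay. -/
theorem card_mul_norm_sq_le_normASq (X : ι → E d) (i : ι) :
    (Fintype.card ι : ℝ) / 2 * ‖X i‖ ^ 2 ≤ normASq X := by
  have h1 : ∑ k, ‖X k - X i‖ ^ 2 ≤ 1 / 2 * ∑ i, ∑ k, ‖X i - X k‖ ^ 2 := by
    -- Each pair containing `i` occurs twice in the double sum, once in row `i` and once in column
    -- `i`; this cancels the factor one half.
    have h2 : ∀ k, ‖X k - X i‖ ^ 2 + (if k = i then ∑ l, ‖X i - X l‖ ^ 2 else 0) ≤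
        ∑ l, ‖X k - X l‖ ^ 2 := by
      intro k
      split_ifs with h
      · simp [h]
      · rw [add_zero]
        exact Finset.single_le_sum (f := fun l => ‖X k - X l‖ ^ 2) (fun _ _ => by positivity)
          (Finset.mem_univ i)
    have h3 := Finset.sum_le_sum fun k (_ : k ∈ Finset.univ) => h2 k
    rw [Finset.sum_add_distrib, Finset.sum_ite_eq' Finset.univ i] at h3
    simp only [Finset.mem_univ, if_true] at h3
    have h4 : ∑ l, ‖X i - X l‖ ^ 2 = ∑ l, ‖X l - X i‖ ^ 2 :=
      Finset.sum_congr rfl fun l _ => by rw [norm_sub_rev]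
    linarith
  have h5 : ∑ k : ι, 1 / 2 * ‖X i‖ ^ 2 ≤ ∑ k, (‖X k‖ ^ 2 + ‖X k - X i‖ ^ 2) := by
    refine Finset.sum_le_sum fun k _ => ?_
    have : ‖X i‖ ≤ ‖X k‖ + ‖X k - X i‖ := by
      calc ‖X i‖ = ‖X k - (X k - X i)‖ := by congr 1; abel
        _ ≤ _ := norm_sub_le _ _
    nlinarith [norm_nonneg (X i), sq_nonneg (‖X k‖ - ‖X k - X i‖)]
  rw [Finset.sum_add_distrib] at h5
  simp only [Finset.sum_const, Finset.card_univ, nsmul_eq_mul] at h5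
  rw [normASq_eq_add]
  linarith

theorem taskVariance_eq (X : ι → E d) :
    taskVariance X = 1 / ((Fintype.card ι : ℝ) - 1) *
      (∑ i, ‖X i‖ ^ 2 - 1 / (Fintype.card ι : ℝ) * ‖∑ i, X i‖ ^ 2) := by
  unfold taskVariance
  congr 1
  rcases eq_or_ne (Fintype.card ι : ℝ) 0 with h0 | h0
  · have : IsEmpty ι := by
      rw [← Fintype.card_eq_zero_iff]; exact_mod_cast h0
    simp
  simp only [norm_sub_sq_real, Finset.sum_add_distrib, Finset.sum_sub_distrib, ← Finset.mul_sum,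
    inner_smul_right, norm_smul, mul_pow]
  rw [← sum_inner, real_inner_self_eq_norm_sq]
  simp only [Finset.sum_const, Finset.card_univ, nsmul_eq_mul, Real.norm_eq_abs, sq_abs]
  field_simp
  ring

theorem taskVariance_eq_sum (X : ι → E d) :
    taskVariance X = 1 / (2 * (Fintype.card ι : ℝ) * ((Fintype.card ι : ℝ) - 1)) *
      ∑ i, ∑ k, ‖X i - X k‖ ^ 2 := by
  rw [taskVariance_eq, sum_sum_norm_sub_sq]
  rcases eq_or_ne (Fintype.card ι : ℝ) 0 with h0 | h0
  · have : IsEmpty ι := by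
      rw [← Fintype.card_eq_zero_iff]; exact_mod_cast h0
    simp
  rcases eq_or_ne ((Fintype.card ι : ℝ) - 1) 0 with h1 | h1
  · simp [h1]
  field_simp

theorem taskVariance_nonneg [Nonempty ι] (X : ι → E d) : 0 ≤ taskVariance X := by
  have h : (1 : ℝ) ≤ Fintype.card ι := by exact_mod_cast Fintype.card_pos (α := ι)
  have : 0 ≤ (Fintype.card ι : ℝ) - 1 := by linarith
  unfold taskVariance
  positivity

/-- `‖X‖_A ^ 2` in terms of the variance of the rows. -/
theorem normASq_eq_taskVariance [Nonempty ι] (X : ι → E d) :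
    normASq X = ∑ i, ‖X i‖ ^ 2 +
      (Fintype.card ι : ℝ) * (((Fintype.card ι : ℝ) - 1) * taskVariance X) := by
  have h0 : (Fintype.card ι : ℝ) ≠ 0 := by exact_mod_cast Fintype.card_ne_zero (α := ι)
  rcases eq_or_ne ((Fintype.card ι : ℝ) - 1) 0 with h1 | h1
  · have hs : Fintype.card ι = 1 := by
      have : (Fintype.card ι : ℝ) = 1 := by linarith
      exact_mod_cast this
    obtain ⟨i, hi⟩ := Fintype.card_eq_one_iff.1 hs
    rw [normASq_eq_add, h1]
    have : ∀ i k, X i - X k = 0 := fun a b => by rw [hi a, hi b, sub_self]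
    simp [this]
  · rw [normASq_eq, taskVariance_eq]
    field_simp
    ring

theorem normASq_le [Nonempty ι] {X : ι → E d} (hX : ∀ i, ‖X i‖ ≤ 1) :
    normASq X ≤ (Fintype.card ι : ℝ) *
      (1 + ((Fintype.card ι : ℝ) - 1) * taskVariance X) := by
  have h : ∑ i, ‖X i‖ ^ 2 ≤ ∑ i : ι, (1 : ℝ) :=
    Finset.sum_le_sum fun i _ => pow_le_one₀ (norm_nonneg _) (hX i)
  rw [normASq_eq_taskVariance]
  simp only [Finset.sum_const, Finset.card_univ, nsmul_eq_mul, mul_one] at h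
  linarith

theorem normASq_le_two_card_sq [Nonempty ι] {X : ι → E d} (hX : ∀ i, ‖X i‖ ≤ 1) :
    normASq X ≤ (Fintype.card ι : ℝ) * (2 * Fintype.card ι) := by
  have h : ∑ i, ‖X i‖ ^ 2 ≤ ∑ i : ι, (1 : ℝ) :=
    Finset.sum_le_sum fun i _ => pow_le_one₀ (norm_nonneg _) (hX i)
  have h1 : (1 : ℝ) ≤ Fintype.card ι := by exact_mod_cast Fintype.card_pos (α := ι)
  simp only [Finset.sum_const, Finset.card_univ, nsmul_eq_mul, mul_one] at h
  rw [normASq_eq]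
  nlinarith [sq_nonneg ‖∑ i, X i‖]

theorem convexOn_taskVariance [Nonempty ι] :
    ConvexOn ℝ Set.univ (taskVariance : (ι → E d) → ℝ) := by
  have h : (1 : ℝ) ≤ Fintype.card ι := by exact_mod_cast Fintype.card_pos (α := ι)
  have h0 : 0 ≤ 1 / ((Fintype.card ι : ℝ) - 1) := by
    have : 0 ≤ (Fintype.card ι : ℝ) - 1 := by linarith
    positivity
  refine ⟨convex_univ, fun X _ Y _ a b ha hb hab => ?_⟩
  unfold taskVariance
  rw [smul_eq_mul, smul_eq_mul, mul_left_comm, mul_left_comm b, ← mul_add]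
  refine mul_le_mul_of_nonneg_left ?_ h0
  rw [Finset.mul_sum, Finset.mul_sum, ← Finset.sum_add_distrib]
  refine Finset.sum_le_sum fun i _ => ?_
  have e : (a • X + b • Y) i - (1 / (Fintype.card ι : ℝ)) • ∑ k, (a • X + b • Y) k =
      a • (X i - (1 / (Fintype.card ι : ℝ)) • ∑ k, X k) +
        b • (Y i - (1 / (Fintype.card ι : ℝ)) • ∑ k, Y k) := by
    simp only [Pi.add_apply, Pi.smul_apply, Finset.sum_add_distrib, ← Finset.smul_sum, smul_add,
      smul_sub]
    rw [smul_comm a, smul_comm b]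
    abel
  rw [e]
  have := ((convexOn_norm (E := E d) convex_univ).pow (fun _ _ => norm_nonneg _) 2).2
    (Set.mem_univ (X i - (1 / (Fintype.card ι : ℝ)) • ∑ k, X k))
    (Set.mem_univ (Y i - (1 / (Fintype.card ι : ℝ)) • ∑ k, Y k)) ha hb hab
  simpa using this

theorem convex_feasible [Nonempty ι] (capTop : Prop) (ξ : ℝ) :
    Convex ℝ (feasible capTop ξ : Set (ι → E d)) := by
  intro X hX Y hY a b ha hb hab
  refine ⟨fun i => ?_, fun h => ?_⟩
  · have := (convex_closedBall (0 : E d) 1) (mem_closedBall_zero_iff.2 (hX.1 i))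
      (mem_closedBall_zero_iff.2 (hY.1 i)) ha hb hab
    simpa using this
  · refine (convexOn_taskVariance.2 (Set.mem_univ X) (Set.mem_univ Y) ha hb hab).trans ?_
    have h1 := hX.2 h
    have h2 := hY.2 h
    rw [smul_eq_mul, smul_eq_mul]
    calc _ ≤ a * ξ + b * ξ := by gcongr
      _ = ξ := by rw [← add_mul, hab, one_mul]

theorem continuous_taskVariance : Continuous (taskVariance : (ι → E d) → ℝ) := by
  unfold taskVariance
  fun_prop

theorem isCompact_feasible (capTop : Prop) (ξ : ℝ) :
    IsCompact (feasible capTop ξ : Set (ι → E d)) := by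
  have h1 : IsCompact (Set.univ.pi fun _ : ι => Metric.closedBall (0 : E d) 1) :=
    isCompact_univ_pi fun _ => isCompact_closedBall _ _
  have h2 : IsClosed {X : ι → E d | ξ < 1 ∨ capTop → taskVariance X ≤ ξ} := by
    by_cases h : ξ < 1 ∨ capTop
    · simpa [h] using isClosed_le continuous_taskVariance continuous_const
    · simp [h]
  convert h1.inter_right h2 using 1
  ext X
  simp [feasible]

theorem zero_mem_feasible {capTop : Prop} {ξ : ℝ} (hξ : 0 ≤ ξ) :
    (0 : ι → E d) ∈ feasible capTop ξ := by
  refine ⟨by simp, fun _ => ?_⟩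
  simpa [taskVariance] using hξ

theorem continuous_ftrlObjective (η : ℝ) (L : List (ι × E d)) :
    Continuous (ftrlObjective η L) := by
  unfold ftrlObjective normASq
  fun_prop

theorem expertModel_spec (capTop : Prop) (β : ℕ → ℝ) {ξ : ℝ} (hξ : 0 ≤ ξ) (L : List (ι × E d)) :
    expertModel capTop β ξ L ∈ feasible capTop ξ ∧
      IsMinOn (ftrlObjective (expertRate ι (β L.length) ξ) L) (feasible capTop ξ)
        (expertModel capTop β ξ L) := by
  obtain ⟨X, hX⟩ := (isCompact_feasible capTop ξ).exists_isMinOn ⟨0, zero_mem_feasible hξ⟩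
    (continuous_ftrlObjective (expertRate ι (β L.length) ξ) L).continuousOn
  exact Classical.epsilon_spec (p := fun X => X ∈ feasible capTop ξ ∧
      IsMinOn (ftrlObjective (expertRate ι (β L.length) ξ) L) (feasible capTop ξ) X) ⟨X, hX⟩

theorem normASq_add_smul (X D : ι → E d) (t : ℝ) :
    normASq (X + t • D) = normASq X +
      t * (2 * ((1 + (Fintype.card ι : ℝ)) * ∑ i, inner ℝ (X i) (D i) -
        inner ℝ (∑ i, X i) (∑ i, D i))) + t ^ 2 * normASq D := by
  simp only [normASq_eq, Pi.add_apply, Pi.smul_apply, Finset.sum_add_distrib, ← Finset.smul_sum,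
    norm_add_sq_real, inner_smul_right, norm_smul, mul_pow, Real.norm_eq_abs, sq_abs,
    ← Finset.mul_sum]
  ring

/-- Quadratic growth of the objective around its constrained minimizer. -/
theorem ftrlObjective_quadratic_growth {K : Set (ι → E d)} (hK : Convex ℝ K) {η : ℝ}
    {L : List (ι × E d)} {X Y : ι → E d} (hX : X ∈ K) (hmin : IsMinOn (ftrlObjective η L) K X)
    (hY : Y ∈ K) :
    ftrlObjective η L X + 1 / 2 * normASq (Y - X) ≤ ftrlObjective η L Y := by
  set D := Y - X with hD
  set l : ℝ := η * ∑ i, inner ℝ (gradSum L i) (D i) +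
    ((1 + (Fintype.card ι : ℝ)) * ∑ i, inner ℝ (X i) (D i) -
        inner ℝ (∑ i, X i) (∑ i, D i)) with hl
  have hF : ∀ t : ℝ, ftrlObjective η L (X + t • D) =
      ftrlObjective η L X + t * l + t ^ 2 * (1 / 2 * normASq D) := by
    intro t
    unfold ftrlObjective
    rw [normASq_add_smul, hl]
    simp only [Pi.add_apply, Pi.smul_apply, inner_add_right, inner_smul_right,
      Finset.sum_add_distrib, ← Finset.mul_sum]
    ring
  -- First-order optimality: a negative slope `l` would make the objective decrease along the
  -- segment from `X` to `Y`. The step `-l / (-l + c + 1)` lies in `(0, 1]` and is short enough for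
  -- the linear term to beat `t ^ 2 * c`.
  have hl0 : 0 ≤ l := by
    by_contra! h
    set c := 1 / 2 * normASq D with hc
    have hc0 : 0 ≤ c := by have := normASq_nonneg D; positivity
    have ht : 0 < -l / (-l + c + 1) := by apply div_pos <;> linarith
    have ht1 : -l / (-l + c + 1) ≤ 1 := (div_le_one (by linarith)).2 (by linarith)
    set t := -l / (-l + c + 1) with ht_def
    have hm := hmin (hK.add_smul_sub_mem hX hY ⟨ht.le, ht1⟩)
    rw [Set.mem_ofPred_eq, ← hD, hF t] at hm
    have h1 : t * (-l + c + 1) = -l := div_mul_cancel₀ _ (by linarith)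
    have h2 : 0 ≤ l + t * c := by
      by_contra! h3
      nlinarith
    nlinarith
  have h1 := hF 1
  have e : X + (1 : ℝ) • D = Y := by rw [hD]; simp
  rw [e] at h1
  linarith

theorem gradSum_concat (L : List (ι × E d)) (r : ι × E d) (i : ι) :
    gradSum (L ++ [r]) i = gradSum L i + if r.1 = i then r.2 else 0 := by
  simp [gradSum]

theorem sum_inner_gradSum_concat (L : List (ι × E d)) (r : ι × E d) (Y : ι → E d) :
    ∑ i, inner ℝ (gradSum (L ++ [r]) i) (Y i) =
      ∑ i, inner ℝ (gradSum L i) (Y i) + inner ℝ r.2 (Y r.1) := by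
  simp only [gradSum_concat, inner_add_left, Finset.sum_add_distrib]
  congr 1
  rw [Finset.sum_eq_single r.1]
  · simp
  · intro i _ hi; simp [hi.symm]
  · simp

theorem sum_inner_gradSum (L : List (ι × E d)) (Y : ι → E d) :
    ∑ i, inner ℝ (gradSum L i) (Y i) = pathSum (fun _ r => inner ℝ r.2 (Y r.1)) L := by
  induction L using List.reverseRecOn with
  | nil => simp [gradSum]
  | append_singleton L r ih => rw [sum_inner_gradSum_concat, pathSum_concat, ih]

theorem expertLoss_eq (capTop : Prop) (β : ℕ → ℝ) (ξ : ℝ) (L : List (ι × E d)) :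
    expertLoss capTop β ξ L =
      pathSum (fun l r => inner ℝ r.2 (expertModel capTop β ξ l r.1)) L := rfl

/-- Induction on the rounds in the manner of "be the leader": the bound for shorter histories is
used with the current leader as comparator, and optimality passes from the leader to `Y`. The
quadratic gain in this passage pays for predicting without knowing the new gradient. -/
theorem expertLoss_le [Nonempty ι] (capTop : Prop) {β : ℕ → ℝ} (hβ : ∀ n, 0 < β n)
    (hmono : Monotone β) {ξ : ℝ} (hξ : 0 ≤ ξ) (L : List (ι × E d)) {Y : ι → E d}
    (hY : Y ∈ feasible capTop ξ) :
    expertLoss capTop β ξ L ≤ pathSum (fun _ r => inner ℝ r.2 (Y r.1)) L +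
      1 / 2 * normASq Y * (β (L.length - 1) /
        ((Fintype.card ι : ℝ) * √(1 + ξ * ((Fintype.card ι : ℝ) - 1)))) +
      pathSum (fun l r => √(1 + ξ * ((Fintype.card ι : ℝ) - 1)) * (‖r.2‖ ^ 2 / β l.length)) L := by
  have hn : (1 : ℝ) ≤ Fintype.card ι := by exact_mod_cast Fintype.card_pos (α := ι)
  set n : ℝ := (Fintype.card ι : ℝ) with hn_def
  set κ := √(1 + ξ * (n - 1)) with hκ_def
  have hκ : 0 < κ := Real.sqrt_pos.2 (by nlinarith)
  rw [← sum_inner_gradSum]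
  induction L using List.reverseRecOn generalizing Y with
  | nil =>
    have := normASq_nonneg Y
    have := hβ 0
    simp only [expertLoss_eq, pathSum_nil, gradSum, List.map_nil, List.sum_nil, inner_zero_left,
      Finset.sum_const_zero, zero_add, add_zero]
    simp only [List.length_nil, zero_tsub]
    positivity
  | append_singleton L r ih =>
    rw [expertLoss_eq, pathSum_concat, ← expertLoss_eq, pathSum_concat, sum_inner_gradSum_concat]
    simp only [List.length_append, List.length_singleton, add_tsub_cancel_right]
    obtain ⟨hXm, hXmin⟩ := expertModel_spec capTop β hξ L
    set X := expertModel capTop β ξ L with hX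
    have h1 := ih hXm
    have hb := hβ L.length
    have h2 := ftrlObjective_quadratic_growth (convex_feasible capTop ξ) hXm hXmin hY
    have hη : expertRate ι (β L.length) ξ = n / β L.length * κ := rfl
    unfold ftrlObjective at h2
    rw [hη] at h2
    have h3 : β (L.length - 1) / (n * κ) ≤ β L.length / (n * κ) := by
      gcongr
      exact hmono (Nat.sub_le _ _)
    have h4 : 1 / 2 * normASq X * (β (L.length - 1) / (n * κ)) ≤
        1 / 2 * normASq X * (β L.length / (n * κ)) :=
      mul_le_mul_of_nonneg_left h3 (by have := normASq_nonneg X; positivity)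
    have h5 := mul_le_mul_of_nonneg_left h2 (show 0 ≤ β L.length / (n * κ) by positivity)
    have hc : β L.length / (n * κ) * (n / β L.length * κ) = 1 := by field_simp
    have h6 := card_mul_norm_sq_le_normASq (Y - X) r.1
    have h7 : inner ℝ r.2 (X r.1) - inner ℝ r.2 (Y r.1) ≤ ‖r.2‖ * ‖(Y - X) r.1‖ := by
      rw [← inner_sub_right, Pi.sub_apply, norm_sub_rev]
      exact real_inner_le_norm _ _
    rw [← hn_def] at h6
    set z := ‖(Y - X) r.1‖ with hz
    set g := ‖r.2‖ with hg
    -- Weighted AM-GM: the difference of the two sides is a square. The first term is covered by the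
    -- quadratic growth, the second is the cost of the round.
    have h8 : g * z ≤ β L.length / (n * κ) * (1 / 2 * (n / 2 * z ^ 2)) +
        κ * (g ^ 2 / β L.length) := by
      have e : β L.length / (n * κ) * (1 / 2 * (n / 2 * z ^ 2)) +
        κ * (g ^ 2 / β L.length) - g * z =
          (β L.length * z / 2 - κ * g) ^ 2 / (β L.length * κ) := by field_simp; ring
      have : 0 ≤ (β L.length * z / 2 - κ * g) ^ 2 / (β L.length * κ) := by positivity
      linarith
    have h9 : β L.length / (n * κ) * (1 / 2 * (n / 2 * z ^ 2)) ≤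
        β L.length / (n * κ) * (1 / 2 * normASq (Y - X)) := by gcongr
    simp only [mul_add, ← mul_assoc] at h5
    simp only [mul_assoc (β L.length / (n * κ)) (n / β L.length) κ, hc, one_mul] at h5
    nlinarith [h1, h4, h5, h7, h8, h9]

end Ftrl

/-! ### Regret of the base algorithm on a clique. -/

section MtFtrl

set_option linter.unusedSectionVars false

variable {ι : Type*} [Fintype ι] [DecidableEq ι] [Nonempty ι] {d : ℕ}

theorem grid_pos (k : Fin (Fintype.card ι)) : 0 < grid ι k := by
  have : (0 : ℝ) < Fintype.card ι := by exact_mod_cast Fintype.card_pos (α := ι)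
  unfold grid
  positivity

theorem norm_expertModel_le (capTop : Prop) (β : ℕ → ℝ) (k : Fin (Fintype.card ι))
    (L : List (ι × E d)) (i : ι) : ‖expertModel capTop β (grid ι k) L i‖ ≤ 1 :=
  (expertModel_spec capTop β (grid_pos k).le L).1.1 i

theorem hedgeExp_pos (capTop : Prop) (β : ℕ → ℝ) (L : List (ι × E d))
    (k : Fin (Fintype.card ι)) : 0 < hedgeExp capTop β L k := Real.exp_pos _

instance : Nonempty (Fin (Fintype.card ι)) := ⟨⟨0, Fintype.card_pos⟩⟩

theorem sum_hedgeExp_pos (capTop : Prop) (β : ℕ → ℝ) (L : List (ι × E d)) :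
    0 < ∑ k, hedgeExp capTop β L k :=
  Finset.sum_pos (fun k _ => hedgeExp_pos capTop β L k) Finset.univ_nonempty

theorem sum_hedge_weights (capTop : Prop) (β : ℕ → ℝ) (L : List (ι × E d)) :
    ∑ k, hedgeExp capTop β L k / ∑ k', hedgeExp capTop β L k' = 1 := by
  rw [← Finset.sum_div, div_self (sum_hedgeExp_pos capTop β L).ne']

theorem mtFtrl_apply (capTop : Prop) (β : ℕ → ℝ) (L : List (ι × E d)) (i : ι) :
    mtFtrl capTop β L i = ∑ k, (hedgeExp capTop β L k / ∑ k', hedgeExp capTop β L k') •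
      expertModel capTop β (grid ι k) L i := by
  simp [mtFtrl]

theorem norm_mtFtrl_le (capTop : Prop) (β : ℕ → ℝ) (L : List (ι × E d)) (i : ι) :
    ‖mtFtrl capTop β L i‖ ≤ 1 := by
  rw [mtFtrl_apply]
  calc _ ≤ ∑ k, ‖(hedgeExp capTop β L k / ∑ k', hedgeExp capTop β L k') •
      expertModel capTop β (grid ι k) L i‖ := norm_sum_le _ _
    _ ≤ ∑ k, hedgeExp capTop β L k / ∑ k', hedgeExp capTop β L k' := by
        refine Finset.sum_le_sum fun k _ => ?_
        have h0 : 0 ≤ hedgeExp capTop β L k / ∑ k', hedgeExp capTop β L k' :=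
          div_nonneg (hedgeExp_pos capTop β L k).le (sum_hedgeExp_pos capTop β L).le
        rw [norm_smul, Real.norm_of_nonneg h0]
        exact mul_le_of_le_one_right h0 (norm_expertModel_le capTop β k L i)
    _ = 1 := sum_hedge_weights capTop β L

/-- The total linearized loss of `MT-FTRL` against the one of an expert. -/
theorem mtFtrl_loss_le (capTop : Prop) {β : ℕ → ℝ} (hβ : ∀ n, 0 < β n)
    (hmono : Monotone β) (L : List (ι × E d)) (k : Fin (Fintype.card ι)) :
    pathSum (fun l r => inner ℝ r.2 (mtFtrl capTop β l r.1)) L ≤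
      expertLoss capTop β (grid ι k) L + 4 * √(Real.log (Fintype.card ι)) *
        (β (L.length - 1) + pathSum (fun l r => ‖r.2‖ ^ 2 / β l.length) L) := by
  have hinner : ∀ (l : List (ι × E d)) (r : ι × E d), inner ℝ r.2 (mtFtrl capTop β l r.1) =
      ∑ k, hedgeExp capTop β l k / (∑ k', hedgeExp capTop β l k') *
        inner ℝ r.2 (expertModel capTop β (grid ι k) l r.1) := fun l r => by
    rw [mtFtrl_apply, inner_sum]
    simp only [inner_smul_right]
  -- With a single task the Hedge rate is zero, so that the Hedge bound does not apply; but then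
  -- there is only one expert.
  rcases (Nat.succ_le_of_lt (Fintype.card_pos (α := ι))).eq_or_lt with h1 | h1
  · have hs : Subsingleton (Fin (Fintype.card ι)) := by rw [← h1]; infer_instance
    have : pathSum (fun l r => inner ℝ r.2 (mtFtrl capTop β l r.1)) L =
        expertLoss capTop β (grid ι k) L := by
      rw [expertLoss_eq]
      refine pathSum_congr fun l _ r _ => ?_
      rw [hinner]
      have : ∀ k', hedgeExp capTop β l k' / (∑ k', hedgeExp capTop β l k') *
          inner ℝ r.2 (expertModel capTop β (grid ι k') l r.1) =
          hedgeExp capTop β l k' / (∑ k', hedgeExp capTop β l k') *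
          inner ℝ r.2 (expertModel capTop β (grid ι k) l r.1) := fun k' => by
        rw [Subsingleton.elim k' k]
      simp only [this]
      rw [← Finset.sum_mul, sum_hedge_weights, one_mul]
    rw [this, ← h1]
    simp
  · have hlog : 0 < Real.log (Fintype.card ι) := Real.log_pos (by exact_mod_cast h1)
    have hsq : 0 < √(Real.log (Fintype.card ι)) := Real.sqrt_pos.2 hlog
    have h := hedge_regret (η := fun n => √(Real.log (Fintype.card ι)) / β n)
      (fun n => div_pos hsq (hβ n)) (fun m n hmn => div_le_div_of_nonneg_left hsq.le (hβ m) (hmono hmn))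
      (fun (k : Fin (Fintype.card ι)) (l : List (ι × E d)) (r : ι × E d) =>
        (inner ℝ r.2 (expertModel capTop β (grid ι k) l r.1) : ℝ)) (fun r => ‖r.2‖) L
      (fun k l r _ => (abs_real_inner_le_norm _ _).trans
        (mul_le_of_le_one_right (norm_nonneg _) (norm_expertModel_le capTop β k l r.1))) k
    simp only [← expertLoss_eq, Fintype.card_fin] at h
    have e1 : pathSum (fun l r => inner ℝ r.2 (mtFtrl capTop β l r.1)) L =
        pathSum (fun l r => ∑ k, Real.exp (-(√(Real.log (Fintype.card ι)) / β l.length *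
            expertLoss capTop β (grid ι k) l)) /
          (∑ k', Real.exp (-(√(Real.log (Fintype.card ι)) / β l.length *
            expertLoss capTop β (grid ι k') l))) *
          inner ℝ r.2 (expertModel capTop β (grid ι k) l r.1)) L :=
      pathSum_congr fun l _ r _ => by
        rw [hinner]
        simp only [hedgeExp, neg_mul]
    have e2 : Real.log (Fintype.card ι) / (√(Real.log (Fintype.card ι)) / β (L.length - 1)) =
        √(Real.log (Fintype.card ι)) * β (L.length - 1) := by
      have := hβ (L.length - 1)
      nth_rewrite 1 [← Real.mul_self_sqrt hlog.le]
      field_simp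
    have e3 : pathSum (fun l (r : ι × E d) =>
        4 * (√(Real.log (Fintype.card ι)) / β l.length) * ‖r.2‖ ^ 2) L =
        4 * √(Real.log (Fintype.card ι)) * pathSum (fun l r => ‖r.2‖ ^ 2 / β l.length) L := by
      rw [← pathSum_const_mul]
      exact pathSum_congr fun l _ r _ => by ring
    rw [e2, e3, ← e1] at h
    have := hβ (L.length - 1)
    nlinarith

/-- The comparator is nearly optimally feasible for some expert. -/
theorem exists_grid {capTop : Prop} {U : ι → E d} (hU : ∀ i, ‖U i‖ ≤ 1)
    (hcap : capTop → taskVariance U ≤ 1) :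
    ∃ k, U ∈ feasible capTop (grid ι k) ∧
      normASq U ≤ 2 * Fintype.card ι * (1 + grid ι k * ((Fintype.card ι : ℝ) - 1)) ∧
      1 + grid ι k * ((Fintype.card ι : ℝ) - 1) ≤
        2 * (1 + taskVariance U * ((Fintype.card ι : ℝ) - 1)) := by
  have hn : (1 : ℝ) ≤ Fintype.card ι := by exact_mod_cast Fintype.card_pos (α := ι)
  have hn0 : (0 : ℝ) < Fintype.card ι := by linarith
  have hs0 := taskVariance_nonneg U
  rcases le_or_gt (taskVariance U) 1 with hs | hs
  · have hk : ⌈(Fintype.card ι : ℝ) * taskVariance U⌉₊ ≤ Fintype.card ι :=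
      Nat.ceil_le.2 (by nlinarith)
    have hpos := Fintype.card_pos (α := ι)
    -- The smallest grid point above the variance. The grid index is shifted by one, and for zero
    -- variance the truncated subtraction selects `1 / n`. Rounding up adds at most `1 / n` to the
    -- variance.
    refine ⟨⟨⌈(Fintype.card ι : ℝ) * taskVariance U⌉₊ - 1, by omega⟩, ?_⟩
    set m := ⌈(Fintype.card ι : ℝ) * taskVariance U⌉₊ with hm
    have hm1 : (Fintype.card ι : ℝ) * taskVariance U ≤ ((m - 1 : ℕ) : ℝ) + 1 := by
      refine (Nat.le_ceil _).trans ?_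
      rw [← hm]
      exact_mod_cast (by omega : m ≤ m - 1 + 1)
    have hm2 : ((m - 1 : ℕ) : ℝ) ≤ (Fintype.card ι : ℝ) * taskVariance U := by
      rcases Nat.eq_zero_or_pos m with h0 | h0
      · rw [h0]; simp only [zero_tsub, Nat.cast_zero]; positivity
      · exact (Nat.lt_ceil.1 (by rw [← hm]; omega)).le
    set ξ : ℝ := grid ι ⟨m - 1, by omega⟩ with hξ
    have hξ' : ξ * Fintype.card ι = ((m - 1 : ℕ) : ℝ) + 1 := by
      rw [hξ, grid]; field_simp
    have h1 : taskVariance U ≤ ξ := by nlinarith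
    have h2 := normASq_le hU
    refine ⟨⟨hU, fun _ => h1⟩, ?_, ?_⟩
    · have : ((Fintype.card ι : ℝ) - 1) * taskVariance U ≤ ξ * ((Fintype.card ι : ℝ) - 1) := by
        nlinarith
      have h4 : 0 ≤ ξ * ((Fintype.card ι : ℝ) - 1) :=
        mul_nonneg (hs0.trans h1) (by linarith)
      nlinarith
    · have : ξ ≤ 1 + taskVariance U := by nlinarith
      have h5 : 0 ≤ ξ := hs0.trans h1
      nlinarith
  -- A variance above one is possible only without the cap; the top expert `ξ = 1` then has no
  -- variance constraint and contains `U`.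
  · have hc : ¬capTop := fun h => absurd (hcap h) (not_le.2 hs)
    have hpos := Fintype.card_pos (α := ι)
    refine ⟨⟨Fintype.card ι - 1, by omega⟩, ?_⟩
    have hξ : grid ι ⟨Fintype.card ι - 1, by omega⟩ = 1 := by
      rw [grid]
      simp only
      rw [Nat.cast_sub hpos]
      field_simp
      simp
    rw [hξ]
    have := normASq_le_two_card_sq hU
    refine ⟨⟨hU, fun h => ?_⟩, by linarith, by nlinarith⟩
    simp [hc] at h

/-- The regret of `MT-FTRL` on a clique. -/
theorem mtFtrl_regret {capTop : Prop} {β : ℕ → ℝ} (hβ : ∀ n, 0 < β n)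
    (hmono : Monotone β) (L : List (ι × E d)) {U : ι → E d} (hU : ∀ i, ‖U i‖ ≤ 1)
    (hcap : capTop → taskVariance U ≤ 1) :
    pathSum (fun l r => inner ℝ r.2 (mtFtrl capTop β l r.1 - U r.1)) L ≤
      8 * √(Real.log (2 * Fintype.card ι)) *
        √(1 + taskVariance U * ((Fintype.card ι : ℝ) - 1)) *
        (β (L.length - 1) + pathSum (fun l r => ‖r.2‖ ^ 2 / β l.length) L) := by
  have hn : (1 : ℝ) ≤ Fintype.card ι := by exact_mod_cast Fintype.card_pos (α := ι)
  have hs0 := taskVariance_nonneg U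
  obtain ⟨k, hk, hA, hκ⟩ := exists_grid hU hcap
  have hξ := grid_pos k
  set ξ := grid ι k
  set n : ℝ := (Fintype.card ι : ℝ)
  have h1 := expertLoss_le capTop hβ hmono hξ.le L hk
  have h2 := mtFtrl_loss_le capTop hβ hmono L k
  set D := pathSum (fun l (r : ι × E d) => ‖r.2‖ ^ 2 / β l.length) L with hD
  have hD0 : 0 ≤ D := pathSum_nonneg fun l r _ => by have := hβ l.length; positivity
  have hb := hβ (L.length - 1)
  set b := β (L.length - 1)
  rw [pathSum_const_mul, ← hD] at h1
  simp only [inner_sub_right]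
  rw [pathSum_sub]
  have hκ1 : 1 ≤ 1 + ξ * (n - 1) := by nlinarith
  have hκ0 : 0 < √(1 + ξ * (n - 1)) := Real.sqrt_pos.2 (by linarith)
  have h3 : 1 / 2 * normASq U * (b / (n * √(1 + ξ * (n - 1)))) ≤ √(1 + ξ * (n - 1)) * b := by
    have e : √(1 + ξ * (n - 1)) * b =
        1 / 2 * (2 * n * (1 + ξ * (n - 1))) * (b / (n * √(1 + ξ * (n - 1)))) := by
      nth_rewrite 2 [← Real.mul_self_sqrt (by linarith : 0 ≤ 1 + ξ * (n - 1))]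
      field_simp
    rw [e]
    gcongr
  have h4 : √(1 + ξ * (n - 1)) ≤ 2 * √(1 + taskVariance U * (n - 1)) := by
    calc √(1 + ξ * (n - 1)) ≤ √(2 ^ 2 * (1 + taskVariance U * (n - 1))) := by
          apply Real.sqrt_le_sqrt
          nlinarith
      _ = _ := by rw [Real.sqrt_mul (by norm_num), Real.sqrt_sq (by norm_num)]
  have hK : 1 ≤ √(1 + taskVariance U * (n - 1)) := Real.one_le_sqrt.2 (by nlinarith)
  set K := √(1 + taskVariance U * (n - 1))
  have h5 : √(Real.log n) ≤ √(Real.log (2 * n)) :=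
    Real.sqrt_le_sqrt (Real.log_le_log (by linarith) (by linarith))
  -- The factor 2 inside the logarithm keeps it away from zero at `n = 1`, so that it also absorbs
  -- the expert's regret.
  have h6 : 1 / 2 ≤ √(Real.log (2 * n)) := by
    apply Real.le_sqrt_of_sq_le
    have : Real.log 2 ≤ Real.log (2 * n) := Real.log_le_log (by norm_num) (by linarith)
    have := Real.log_two_gt_d9
    norm_num at this ⊢
    linarith
  set l := √(Real.log (2 * n))
  have h7 : √(1 + ξ * (n - 1)) * (b + D) ≤ 2 * K * (b + D) := by gcongr
  have h8 : 4 * √(Real.log n) * (b + D) ≤ 4 * (l * K) * (b + D) := by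
    have : √(Real.log n) ≤ l * K := by nlinarith
    gcongr
  have h9 : 2 * K * (b + D) ≤ 4 * (l * K) * (b + D) := by
    have : 2 * K ≤ 4 * (l * K) := by nlinarith
    gcongr
  linarith

/-- Comparator and predictions both lie in the unit ball. Nothing is asked of `β`: this is the
fallback when the estimated rate is unreliable or zero. -/
theorem mtFtrl_regret_le_sum_norm (capTop : Prop) (β : ℕ → ℝ) (L : List (ι × E d)) {U : ι → E d}
    (hU : ∀ i, ‖U i‖ ≤ 1) :
    pathSum (fun l r => inner ℝ r.2 (mtFtrl capTop β l r.1 - U r.1)) L ≤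
      pathSum (fun _ r => 2 * ‖r.2‖) L := by
  refine pathSum_mono fun l r _ => (real_inner_le_norm _ _).trans ?_
  have := (norm_sub_le (mtFtrl capTop β l r.1) (U r.1)).trans
    (add_le_add (norm_mtFtrl_le capTop β l r.1) (hU r.1))
  nlinarith [norm_nonneg r.2]

end MtFtrl

/-! ### Expectations over independent activations. -/

section Average

set_option linter.unusedSectionVars false

variable {α : Type*} [Fintype α]

/-- The expectation of `f` at a list of `n` independent elements with law `q`. -/
noncomputable def avg (q : α → ℝ) : ℕ → (List α → ℝ) → ℝ
  | 0, f => f []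
  | n + 1, f => avg q n fun l => ∑ i, q i * f (l ++ [i])

variable {q : α → ℝ}

theorem avg_add (n : ℕ) (f g : List α → ℝ) :
    avg q n (fun l => f l + g l) = avg q n f + avg q n g := by
  induction n generalizing f g with
  | zero => rfl
  | succ n ih => simp only [avg, mul_add, Finset.sum_add_distrib, ih]

theorem avg_const_mul (n : ℕ) (c : ℝ) (f : List α → ℝ) :
    avg q n (fun l => c * f l) = c * avg q n f := by
  induction n generalizing f with
  | zero => rfl
  | succ n ih => simp only [avg, ← ih, Finset.mul_sum, mul_left_comm]

theorem avg_mono (hq : ∀ i, 0 ≤ q i) (n : ℕ) {f g : List α → ℝ} (h : ∀ l, f l ≤ g l) :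
    avg q n f ≤ avg q n g := by
  induction n generalizing f g with
  | zero => exact h _
  | succ n ih => exact ih fun l => Finset.sum_le_sum fun i _ => mul_le_mul_of_nonneg_left (h _) (hq i)

theorem avg_const (hq1 : ∑ i, q i = 1) (n : ℕ) (c : ℝ) : avg q n (fun _ => c) = c := by
  induction n with
  | zero => rfl
  | succ n ih => simp only [avg, ← Finset.sum_mul, hq1, one_mul, ih]

theorem avg_sum {κ : Type*} (s : Finset κ) (n : ℕ) (f : κ → List α → ℝ) :
    avg q n (fun l => ∑ k ∈ s, f k l) = ∑ k ∈ s, avg q n (f k) := by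
  induction n generalizing f with
  | zero => rfl
  | succ n ih => simp only [avg, ← ih, Finset.mul_sum, Finset.sum_comm (s := s)]

/-- `avg` peels off the last round, so the inner sum is the conditional expectation given the past
and the expected drifts add up. -/
theorem avg_le_of_drift (hq : ∀ i, 0 ≤ q i) {f g : List α → ℝ} {c : ℝ}
    (h : ∀ l, ∑ i, q i * f (l ++ [i]) ≤ f l + g l) (hg : ∀ n, avg q n g ≤ c) (n : ℕ) :
    avg q n f ≤ f [] + n * c := by
  induction n with
  | zero => simp [avg]
  | succ n ih =>
    have h1 : avg q (n + 1) f ≤ avg q n f + avg q n g := by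
      rw [← avg_add]; exact avg_mono hq n h
    have := hg n
    push_cast
    linarith

theorem avg_eq_sum (n : ℕ) (f : List α → ℝ) :
    avg q n f = ∑ a : Fin n → α, (∏ t, q (a t)) * f (List.ofFn a) := by
  induction n generalizing f with
  | zero => simp [avg]
  | succ n ih =>
    rw [avg, ih, ← (Fin.snocEquiv fun _ => α).sum_comp, Fintype.sum_prod_type, Finset.sum_comm]
    refine Finset.sum_congr rfl fun a _ => ?_
    rw [Finset.mul_sum]
    refine Finset.sum_congr rfl fun i _ => ?_
    rw [Fin.prod_univ_castSucc, List.ofFn_succ']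
    simp [Fin.snocEquiv, mul_assoc]

variable [DecidableEq α]

/-- The rounds in which an element of `S` is active. -/
def visits (S : Finset α) (l : List α) : List α := l.filter (· ∈ S)

theorem mem_of_mem_visits {S : Finset α} {l : List α} {i : α} (h : i ∈ visits S l) : i ∈ S := by
  simpa using List.of_mem_filter h

theorem sum_visits_concat (hq1 : ∑ i, q i = 1) (S : Finset α) (F : List α → ℝ) (l : List α) :
    ∑ i, q i * F (visits S (l ++ [i])) =
      F (visits S l) + ∑ i ∈ S, q i * (F (visits S l ++ [i]) - F (visits S l)) := by
  have h : ∀ i, q i * F (visits S (l ++ [i])) = q i * F (visits S l) +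
      if i ∈ S then q i * (F (visits S l ++ [i]) - F (visits S l)) else 0 := by
    intro i
    by_cases hi : i ∈ S
    · simp only [visits, List.filter_append, List.filter_singleton, hi, decide_true, if_true,
        cond_true]
      ring
    · simp [visits, List.filter_append, hi]
  simp only [h]
  rw [Finset.sum_add_distrib, ← Finset.sum_mul, hq1, one_mul, Finset.sum_ite_mem,
    Finset.univ_inter]

theorem avg_visits_le (hq : ∀ i, 0 ≤ q i) (hq1 : ∑ i, q i = 1) (S : Finset α)
    {F g : List α → ℝ} {c : ℝ}
    (h : ∀ I, ∑ i ∈ S, q i * (F (I ++ [i]) - F I) ≤ g I)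
    (hg : ∀ n, avg q n (fun l => g (visits S l)) ≤ c) (n : ℕ) :
    avg q n (fun l => F (visits S l)) ≤ F [] + n * c := by
  refine avg_le_of_drift (g := fun l => g (visits S l)) hq (fun l => ?_) hg n
  rw [sum_visits_concat hq1]
  linarith [h (visits S l)]

theorem avg_visits_le_const (hq : ∀ i, 0 ≤ q i) (hq1 : ∑ i, q i = 1) (S : Finset α)
    {F : List α → ℝ} {c : ℝ}
    (h : ∀ I, ∑ i ∈ S, q i * (F (I ++ [i]) - F I) ≤ c) (n : ℕ) :
    avg q n (fun l => F (visits S l)) ≤ F [] + n * c :=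
  avg_visits_le hq hq1 S h (fun n => (avg_const hq1 n c).le) n

theorem drop_concat_of_lt {τ : ℕ} {I : List α} (h : I.length < τ) (i : α) :
    (I ++ [i]).drop τ = [] ∧ I.drop τ = [] := by
  constructor
  · exact List.drop_eq_nil_of_le (by simp; omega)
  · exact List.drop_eq_nil_of_le (by omega)

theorem drop_concat_of_le {τ : ℕ} {I : List α} (h : τ ≤ I.length) (i : α) :
    (I ++ [i]).drop τ = I.drop τ ++ [i] :=
  List.drop_append_of_le_length h

theorem avg_length_drop_le (hq : ∀ i, 0 ≤ q i) (hq1 : ∑ i, q i = 1) (S : Finset α) (τ n : ℕ) :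
    avg q n (fun l => (((visits S l).drop τ).length : ℝ)) ≤ n * ∑ i ∈ S, q i := by
  have := avg_visits_le_const hq hq1 S (F := fun I => ((I.drop τ).length : ℝ))
    (c := ∑ i ∈ S, q i) (fun I => Finset.sum_le_sum fun i _ => by
      apply mul_le_of_le_one_right (hq i)
      rw [sub_le_iff_le_add]
      norm_cast
      simp only [List.length_drop, List.length_append, List.length_singleton]
      omega) n
  simpa using this

/-- Jensen's inequality for the square root, through its tangent line at `r ^ 2`. -/
theorem avg_sqrt_length_drop_le (hq : ∀ i, 0 ≤ q i) (hq1 : ∑ i, q i = 1) (S : Finset α) (τ : ℕ)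
    {n : ℕ} (h0 : 0 < n * ∑ i ∈ S, q i) :
    avg q n (fun l => √(((visits S l).drop τ).length : ℝ)) ≤ √(n * ∑ i ∈ S, q i) := by
  set r := √(n * ∑ i ∈ S, q i) with hr
  have hr0 : 0 < r := Real.sqrt_pos.2 h0
  have hrr : r * r = n * ∑ i ∈ S, q i := Real.mul_self_sqrt h0.le
  have h1 : ∀ l : List α, √(((visits S l).drop τ).length : ℝ) ≤
      1 / (2 * r) * (((visits S l).drop τ).length : ℝ) + r / 2 := by
    intro l
    set m : ℝ := (((visits S l).drop τ).length : ℝ)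
    have hm : √m * √m = m := Real.mul_self_sqrt (by positivity)
    have e : 1 / (2 * r) * m + r / 2 - √m = (√m - r) ^ 2 / (2 * r) := by
      nth_rewrite 1 [← hm]; field_simp; ring
    have : 0 ≤ (√m - r) ^ 2 / (2 * r) := by positivity
    linarith
  refine (avg_mono hq n h1).trans ?_
  rw [avg_add, avg_const_mul, avg_const hq1]
  have h2 := mul_le_mul_of_nonneg_left (avg_length_drop_le hq hq1 S τ n)
    (show 0 ≤ 1 / (2 * r) by positivity)
  rw [← hrr] at h2
  have h3 : 1 / (2 * r) * (r * r) = r / 2 := by field_simp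
  linarith

/-- Telescoping: each term is at most `2 * √(1 + m) - 2 * √m`. -/
theorem sum_inv_sqrt_le (I : List α) :
    pathSum (fun l (_ : α) => 1 / √(1 + (l.length : ℝ))) I ≤ 2 * √(I.length : ℝ) := by
  induction I using List.reverseRecOn with
  | nil => simp
  | append_singleton I i ih =>
    rw [pathSum_concat]
    simp only [List.length_append, List.length_singleton, Nat.cast_add, Nat.cast_one]
    set m : ℝ := (I.length : ℝ)
    have hm : 0 ≤ m := by positivity
    have h1 : √(1 + m) * √(1 + m) = 1 + m := Real.mul_self_sqrt (by linarith)
    have h2 : √m * √m = m := Real.mul_self_sqrt hm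
    have h3 : 0 < √(1 + m) := Real.sqrt_pos.2 (by linarith)
    have h4 : 1 / √(1 + m) ≤ 2 * √(1 + m) - 2 * √m := by
      rw [div_le_iff₀ h3]
      nlinarith [sq_nonneg (√(1 + m) - √m)]
    rw [add_comm m 1]
    linarith

/-- `V` is the mean of `x` conditional on an activation in `S`. Replacing `x i` by `V` in the sum
therefore subtracts a martingale. -/
theorem avg_weighted_inv_sqrt_le (hq : ∀ i, 0 ≤ q i) (hq1 : ∑ i, q i = 1) {S : Finset α} (τ : ℕ)
    {x : α → ℝ} {V : ℝ} (hV : 0 ≤ V) (hVS : V * ∑ i ∈ S, q i = ∑ i ∈ S, q i * x i)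
    {n : ℕ} (h0 : 0 < n * ∑ i ∈ S, q i) :
    avg q n (fun l => pathSum (fun l i => x i / √(1 + (l.length : ℝ))) ((visits S l).drop τ)) ≤
      2 * V * √(n * ∑ i ∈ S, q i) := by
  have h1 := avg_visits_le_const hq hq1 S (F := fun I =>
      pathSum (fun l i => x i / √(1 + (l.length : ℝ))) (I.drop τ) +
        (-V) * pathSum (fun l _ => 1 / √(1 + (l.length : ℝ))) (I.drop τ)) (c := 0) (fun I => by
    rcases lt_or_ge I.length τ with h | h
    · refine (Finset.sum_eq_zero fun i _ => ?_).le
      simp only [drop_concat_of_lt h i, sub_self, mul_zero]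
    · simp only [drop_concat_of_le h, pathSum_concat]
      set s := √(1 + ((I.drop τ).length : ℝ))
      have : ∀ a b i, q i * (a + x i / s + (-V) * (b + 1 / s) - (a + (-V) * b)) =
          (q i * x i - V * q i) * (1 / s) := fun a b i => by ring
      simp only [this]
      rw [← Finset.sum_mul, Finset.sum_sub_distrib, ← Finset.mul_sum, hVS]
      simp) n
  rw [avg_add, avg_const_mul] at h1
  simp only [List.drop_nil, pathSum_nil, mul_zero, add_zero] at h1
  have h2 := avg_mono hq n fun l => sum_inv_sqrt_le ((visits S l).drop τ)
  rw [avg_const_mul] at h2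
  have h3 := avg_sqrt_length_drop_le hq hq1 S τ h0
  nlinarith

/-- An exponential supermartingale that is frozen after `τ` visits. -/
theorem avg_exp_take_le_one (hq : ∀ i, 0 ≤ q i) (hq1 : ∑ i, q i = 1) {S : Finset α} (τ : ℕ)
    {h : α → ℝ} (hS : ∑ i ∈ S, q i * Real.exp (h i) ≤ ∑ i ∈ S, q i) (n : ℕ) :
    avg q n (fun l => Real.exp ((((visits S l).take τ).map h).sum)) ≤ 1 := by
  have h1 := avg_visits_le_const hq hq1 S (F := fun I => Real.exp (((I.take τ).map h).sum))
    (c := 0) (fun I => by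
      rcases lt_or_ge I.length τ with hI | hI
      · have e1 : ∀ i, (I ++ [i]).take τ = I ++ [i] := fun i =>
          List.take_of_length_le (by simp; omega)
        have e2 : I.take τ = I := List.take_of_length_le hI.le
        simp only [e1, e2, List.map_append, List.sum_append, List.map_singleton,
          List.sum_singleton, Real.exp_add]
        have : ∀ a i, q i * (a * Real.exp (h i) - a) = a * (q i * Real.exp (h i) - q i) :=
          fun a i => by ring
        simp only [this]
        rw [← Finset.mul_sum, Finset.sum_sub_distrib]
        exact mul_nonpos_of_nonneg_of_nonpos (Real.exp_pos _).le (by linarith)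
      · simp [List.take_append_of_le_length hI]) n
  simpa using h1

/-- The exponential is already frozen when the second factor starts to grow. Each later round adds
`∑ i ∈ S, q i * w i` times the exponential in conditional expectation, and the latter has mean at
most one. -/
theorem avg_exp_take_mul_drop_le (hq : ∀ i, 0 ≤ q i) (hq1 : ∑ i, q i = 1) {S : Finset α} (τ : ℕ)
    {h : α → ℝ} (hS : ∑ i ∈ S, q i * Real.exp (h i) ≤ ∑ i ∈ S, q i)
    {w : α → ℝ} (hw : ∀ i ∈ S, 0 ≤ w i) (n : ℕ) :
    avg q n (fun l => Real.exp ((((visits S l).take τ).map h).sum) *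
      (((visits S l).drop τ).map w).sum) ≤ n * ∑ i ∈ S, q i * w i := by
  have hc : 0 ≤ ∑ i ∈ S, q i * w i := Finset.sum_nonneg fun i hi => mul_nonneg (hq i) (hw i hi)
  have h1 := avg_visits_le hq hq1 S
    (F := fun I => Real.exp (((I.take τ).map h).sum) * ((I.drop τ).map w).sum)
    (g := fun I => (∑ i ∈ S, q i * w i) * Real.exp (((I.take τ).map h).sum))
    (c := ∑ i ∈ S, q i * w i) (fun I => by
      rcases lt_or_ge I.length τ with hI | hI
      · refine (Finset.sum_eq_zero fun i _ => ?_).le.trans (mul_nonneg hc (Real.exp_pos _).le)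
        simp only [drop_concat_of_lt hI i]
        simp
      · simp only [drop_concat_of_le hI, List.take_append_of_le_length hI, List.map_append,
          List.sum_append, List.map_singleton, List.sum_singleton]
        rw [Finset.sum_mul]
        refine (Finset.sum_congr rfl fun i _ => ?_).le
        ring)
    (fun n => by
      rw [avg_const_mul]
      exact mul_le_of_le_one_right hc (avg_exp_take_le_one hq hq1 τ hS n)) n
  simpa using h1

theorem exp_le_one_add_two_mul {y : ℝ} (h0 : 0 ≤ y) (h1 : y ≤ 1) : Real.exp y ≤ 1 + 2 * y := by
  have := (abs_le.1 (Real.abs_exp_sub_one_sub_id_le (abs_le.2 ⟨by linarith, h1⟩))).2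
  nlinarith

theorem exp_neg_le_one_sub_half {y : ℝ} (h0 : 0 ≤ y) (h1 : y ≤ 1) :
    Real.exp (-y) ≤ 1 - y / 2 := by
  have h2 : 1 + y ≤ Real.exp y := by linarith [Real.add_one_le_exp y]
  rw [Real.exp_neg, inv_le_iff_one_le_mul₀ (Real.exp_pos y)]
  nlinarith

theorem sum_map_sub_const (y : α → ℝ) (a c : ℝ) (I : List α) :
    (I.map fun i => a * y i + c).sum = a * (I.map y).sum + I.length * c := by
  induction I with
  | nil => simp
  | cons i I ih => simp only [List.map_cons, List.sum_cons, ih, List.length_cons]; push_cast; ring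

/-- The expectation of the bound on the second phase: the first alternative applies if the
empirical second moment of the weights in the first phase is of the right order. -/
theorem avg_second_phase_le (hq : ∀ i, 0 < q i) (hq1 : ∑ i, q i = 1) {S : Finset α}
    (hS : S.Nonempty) {w : α → ℝ} (hw : ∀ i ∈ S, 0 ≤ w i) {V qm Λ c : ℝ} (hV : 0 < V)
    (hVS : V * ∑ i ∈ S, q i = ∑ i ∈ S, q i * w i ^ 2) (hqm : 0 < qm) (hqm' : ∀ i, qm ≤ q i)
    (hΛ : 0 ≤ Λ) {τ T : ℕ} (hτ : 4 * Λ ≤ τ * qm) (hT : 0 < T) (hTΛ : T * Real.exp (-Λ) ≤ 1 / 2)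
    (hc : 0 ≤ c) {Z : List α → ℝ}
    (hgood : ∀ l, τ ≤ (visits S l).length →
      τ * V / 4 ≤ (((visits S l).take τ).map fun i => w i ^ 2).sum →
      (((visits S l).take τ).map fun i => w i ^ 2).sum ≤ 4 * (τ * V) →
      Z l ≤ c * (2 * √V * √(((visits S l).drop τ).length : ℝ) + 2 / √V *
        pathSum (fun l i => w i ^ 2 / √(1 + (l.length : ℝ))) ((visits S l).drop τ)))
    (hbad : ∀ l, Z l ≤ 2 * (((visits S l).drop τ).map w).sum) :
    avg q T Z ≤ (6 * c + 2) * (√(∑ i ∈ S, q i * w i ^ 2) * √(T : ℝ)) := by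
  have hq0 : ∀ i, 0 ≤ q i := fun i => (hq i).le
  set Q := ∑ i ∈ S, q i with hQ
  have hQ1 : Q ≤ 1 := by
    rw [← hq1]; exact Finset.sum_le_univ_sum_of_nonneg hq0
  have hQ0 : 0 < Q := Finset.sum_pos (fun i _ => hq i) hS
  -- Normalized so that `y ≤ 1` on `S`, while its mean conditional on an activation in `S` is
  -- exactly `qm`. The exponents `y - 2 * qm` and `-y + qm / 2` then give supermartingales for the
  -- upper and the lower deviation.
  set y : α → ℝ := fun i => qm / V * w i ^ 2 with hy
  have hy0 : ∀ i, 0 ≤ y i := fun i => by positivity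
  have hy1 : ∀ i ∈ S, y i ≤ 1 := fun i hi => by
    have h1 : q i * w i ^ 2 ≤ V * Q := by
      rw [hVS]
      exact Finset.single_le_sum (f := fun i => q i * w i ^ 2)
        (fun i _ => mul_nonneg (hq0 i) (sq_nonneg _)) hi
    have h2 : qm * w i ^ 2 ≤ V := by nlinarith [hqm' i, sq_nonneg (w i)]
    rw [hy]
    simp only
    rw [div_mul_eq_mul_div, div_le_one hV]
    exact h2
  have hyS : ∑ i ∈ S, q i * y i = qm * Q := by
    have : ∀ i, q i * y i = qm / V * (q i * w i ^ 2) := fun i => by rw [hy]; ring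
    simp only [this]
    rw [← Finset.mul_sum, ← hVS]
    field_simp
  have hplus : ∑ i ∈ S, q i * Real.exp (1 * y i + -(2 * qm)) ≤ Q := by
    calc _ ≤ ∑ i ∈ S, Real.exp (-(2 * qm)) * (q i + 2 * (q i * y i)) :=
          Finset.sum_le_sum fun i hi => by
            rw [one_mul, Real.exp_add]
            have := mul_le_mul_of_nonneg_left (exp_le_one_add_two_mul (hy0 i) (hy1 i hi))
              (mul_nonneg (hq0 i) (Real.exp_pos (-(2 * qm))).le)
            linarith
      _ = Real.exp (-(2 * qm)) * (Q * (1 + 2 * qm)) := by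
          rw [← Finset.mul_sum, Finset.sum_add_distrib, ← Finset.mul_sum, hyS]; ring
      _ ≤ Real.exp (-(2 * qm)) * (Q * Real.exp (2 * qm)) := by
          gcongr
          linarith [Real.add_one_le_exp (2 * qm)]
      _ = Q := by rw [mul_left_comm, ← Real.exp_add]; simp
  have hminus : ∑ i ∈ S, q i * Real.exp ((-1) * y i + qm / 2) ≤ Q := by
    calc _ ≤ ∑ i ∈ S, Real.exp (qm / 2) * (q i - 1 / 2 * (q i * y i)) :=
          Finset.sum_le_sum fun i hi => by
            rw [neg_one_mul, Real.exp_add]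
            have := mul_le_mul_of_nonneg_left (exp_neg_le_one_sub_half (hy0 i) (hy1 i hi))
              (mul_nonneg (hq0 i) (Real.exp_pos (qm / 2)).le)
            linarith
      _ = Real.exp (qm / 2) * (Q * (1 - qm / 2)) := by
          rw [← Finset.mul_sum, Finset.sum_sub_distrib, ← Finset.mul_sum, hyS]; ring
      _ ≤ Real.exp (qm / 2) * (Q * Real.exp (-(qm / 2))) := by
          gcongr
          linarith [Real.add_one_le_exp (-(qm / 2))]
      _ = Q := by rw [mul_left_comm, ← Real.exp_add]; simp
  -- Pathwise bound in which the exponentials stand in for the indicator of a bad estimate. If `W >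
  -- 4 * (τ * V)`, the first exponent is at least `2 * τ * qm`; if `W < τ * V / 4`, the second is at
  -- least `τ * qm / 4`. Both are at least `Λ`, and the second case is the one that needs the factor
  -- 4 in the length of the first phase.
  have hZ : ∀ l, Z l ≤ c * (2 * √V * √(((visits S l).drop τ).length : ℝ) + 2 / √V *
        pathSum (fun l i => w i ^ 2 / √(1 + (l.length : ℝ))) ((visits S l).drop τ)) +
      2 * Real.exp (-Λ) * (Real.exp ((((visits S l).take τ).map fun i =>
          1 * y i + -(2 * qm)).sum) * (((visits S l).drop τ).map w).sum +
        Real.exp ((((visits S l).take τ).map fun i => (-1) * y i + qm / 2).sum) *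
          (((visits S l).drop τ).map w).sum) := by
    intro l
    set I := visits S l with hI
    have hM : 0 ≤ ((I.drop τ).map w).sum := List.sum_nonneg fun r hr => by
      obtain ⟨i, hi, rfl⟩ := List.mem_map.1 hr
      exact hw i (mem_of_mem_visits (List.mem_of_mem_drop hi))
    have hP : 0 ≤ pathSum (fun l i => w i ^ 2 / √(1 + (l.length : ℝ))) (I.drop τ) :=
      pathSum_nonneg fun l i _ => by positivity
    have hfirst : 0 ≤ c * (2 * √V * √((I.drop τ).length : ℝ) + 2 / √V *
        pathSum (fun l i => w i ^ 2 / √(1 + (l.length : ℝ))) (I.drop τ)) := by positivity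
    have hb := hbad l
    rw [← hI] at hb
    set M := ((I.drop τ).map w).sum with hMdef
    set A := Real.exp (((I.take τ).map fun i => 1 * y i + -(2 * qm)).sum) with hA
    set B := Real.exp (((I.take τ).map fun i => (-1) * y i + qm / 2).sum) with hB
    have hA0 : 0 < A := Real.exp_pos _
    have hB0 : 0 < B := Real.exp_pos _
    rcases lt_or_ge I.length τ with h | h
    · have : M = 0 := by
        rw [hMdef, List.drop_eq_nil_of_le h.le]; simp
      rw [this] at hb ⊢
      simp only [mul_zero, add_zero] at hb ⊢
      linarith
    have hlen : ((I.take τ).length : ℝ) = τ := by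
      rw [List.length_take, min_eq_left h]
    have hys : ((I.take τ).map y).sum = qm / V * ((I.take τ).map fun i => w i ^ 2).sum := by
      rw [hy, List.sum_map_mul_left]
    rw [sum_map_sub_const, hlen, hys] at hA hB
    set W := ((I.take τ).map fun i => w i ^ 2).sum with hW
    have hfin : 1 ≤ Real.exp (-Λ) * A ∨ 1 ≤ Real.exp (-Λ) * B → 2 * M ≤
        2 * Real.exp (-Λ) * (A * M + B * M) := by
      have hl := Real.exp_pos (-Λ)
      rintro (h1 | h1)
      · have := mul_le_mul_of_nonneg_right h1 hM
        have : 0 ≤ Real.exp (-Λ) * (B * M) := by positivity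
        nlinarith
      · have := mul_le_mul_of_nonneg_right h1 hM
        have : 0 ≤ Real.exp (-Λ) * (A * M) := by positivity
        nlinarith
    by_cases h1 : τ * V / 4 ≤ W
    · by_cases h2 : W ≤ 4 * (τ * V)
      · have hg := hgood l h h1 h2
        have : 0 ≤ 2 * Real.exp (-Λ) * (A * M + B * M) := by positivity
        linarith
      · have := hfin (Or.inl (by
          rw [hA, ← Real.exp_add, Real.one_le_exp_iff]
          have h3 : qm / V * (4 * (τ * V)) ≤ qm / V * W :=
            mul_le_mul_of_nonneg_left (not_le.1 h2).le (by positivity)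
          have h4 : qm / V * (4 * (τ * V)) = 4 * (τ * qm) := by field_simp
          linarith))
        linarith
    · have := hfin (Or.inr (by
        rw [hB, ← Real.exp_add, Real.one_le_exp_iff]
        have h3 : qm / V * W ≤ qm / V * (τ * V / 4) :=
          mul_le_mul_of_nonneg_left (not_le.1 h1).le (by positivity)
        have h4 : qm / V * (τ * V / 4) = (τ * qm) / 4 := by field_simp
        linarith))
      linarith
  refine (avg_mono hq0 T hZ).trans ?_
  simp only [avg_add, avg_const_mul]
  have hT' : (0 : ℝ) < T := by exact_mod_cast hT
  have hTQ : 0 < T * Q := by positivity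
  have b1 := avg_sqrt_length_drop_le hq0 hq1 S τ hTQ
  have b2 := avg_weighted_inv_sqrt_le hq0 hq1 τ hV.le hVS hTQ
  have b3 := avg_exp_take_mul_drop_le hq0 hq1 τ hplus hw T
  have b4 := avg_exp_take_mul_drop_le hq0 hq1 τ hminus hw T
  have hy' : √V * √(T * Q) = √(∑ i ∈ S, q i * w i ^ 2) * √(T : ℝ) := by
    rw [← hVS, ← Real.sqrt_mul hV.le, ← Real.sqrt_mul (by positivity)]
    congr 1; ring
  -- Cauchy-Schwarz with respect to the weights `q`, whose mass on `S` is at most one.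
  have hcs : ∑ i ∈ S, q i * w i ≤ √(∑ i ∈ S, q i * w i ^ 2) := by
    apply Real.le_sqrt_of_sq_le
    have := Finset.sum_mul_sq_le_sq_mul_sq S (fun i => √(q i)) (fun i => √(q i) * w i)
    have e1 : ∀ i, √(q i) * (√(q i) * w i) = q i * w i := fun i => by
      rw [← mul_assoc, Real.mul_self_sqrt (hq0 i)]
    have e2 : ∀ i, √(q i) ^ 2 = q i := fun i => Real.sq_sqrt (hq0 i)
    have e3 : ∀ i, (√(q i) * w i) ^ 2 = q i * w i ^ 2 := fun i => by
      rw [mul_pow, Real.sq_sqrt (hq0 i)]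
    simp only [e1, e2, e3] at this
    refine this.trans (mul_le_of_le_one_left ?_ hQ1)
    exact Finset.sum_nonneg fun i _ => mul_nonneg (hq0 i) (sq_nonneg _)
  set Y := √(∑ i ∈ S, q i * w i ^ 2) with hY
  have hY0 : 0 ≤ Y := Real.sqrt_nonneg _
  have hT1 : 1 ≤ √(T : ℝ) := Real.one_le_sqrt.2 (by exact_mod_cast hT)
  have hsV : 0 < √V := Real.sqrt_pos.2 hV
  have c1 := mul_le_mul_of_nonneg_left b1 (show 0 ≤ 2 * √V by positivity)
  have c2 := mul_le_mul_of_nonneg_left b2 (show 0 ≤ 2 / √V by positivity)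
  have e2 : 2 / √V * (2 * V * √(T * Q)) = 4 * (Y * √(T : ℝ)) := by
    rw [← hy']
    nth_rewrite 2 [← Real.mul_self_sqrt hV.le]
    field_simp
    norm_num
  rw [e2] at c2
  have e1 : 2 * √V * √(T * Q) = 2 * (Y * √(T : ℝ)) := by rw [← hy']; ring
  rw [e1] at c1
  have c3 := mul_le_mul_of_nonneg_left (add_le_add c1 c2) hc
  have c4 := mul_le_mul_of_nonneg_left (add_le_add b3 b4)
    (show 0 ≤ 2 * Real.exp (-Λ) by positivity)
  have hs0 : 0 ≤ ∑ i ∈ S, q i * w i := Finset.sum_nonneg fun i hi => mul_nonneg (hq0 i) (hw i hi)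
  -- The bad event is paid for by `T * exp (-Λ) ≤ 1 / 2`.
  have c5 : 2 * Real.exp (-Λ) * (T * ∑ i ∈ S, q i * w i + T * ∑ i ∈ S, q i * w i) ≤
      2 * (Y * √(T : ℝ)) := by
    have : 2 * Real.exp (-Λ) * (T * ∑ i ∈ S, q i * w i + T * ∑ i ∈ S, q i * w i) =
      4 * (T * Real.exp (-Λ)) * ∑ i ∈ S, q i * w i := by ring
    rw [this]
    calc _ ≤ 4 * (1 / 2) * ∑ i ∈ S, q i * w i := by gcongr
      _ ≤ 2 * (Y * 1) := by linarith
      _ ≤ _ := by gcongr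
  linarith

end Average

theorem pathSum_filterMap {α β : Type*} (φ : α → Option β) (f : List β → β → ℝ) (L : List α) :
    pathSum f (L.filterMap φ) =
      pathSum (fun l a => (φ a).elim 0 fun b => f (l.filterMap φ) b) L := by
  induction L using List.reverseRecOn with
  | nil => simp
  | append_singleton L a ih =>
    rw [List.filterMap_append, pathSum_append, ih, pathSum_concat]
    cases h : φ a with
    | none => simp [h]
    | some b => simp [h, pathSum_cons]

theorem pathSum_finset_sum {α κ : Type*} (s : Finset κ) (f : κ → List α → α → ℝ) (L : List α) :
    pathSum (fun l a => ∑ k ∈ s, f k l a) L = ∑ k ∈ s, pathSum (f k) L :=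
  Finset.sum_comm

theorem sum_countP_mul {κ γ : Type*} [Fintype κ] [DecidableEq κ] (x : κ → ℝ) (L : List (κ × γ)) :
    ∑ i, ((L.countP fun r => decide (r.1 = i) : ℕ) : ℝ) * x i = (L.map fun r => x r.1).sum := by
  induction L with
  | nil => simp
  | cons r L ih =>
    simp only [List.countP_cons, List.map_cons, List.sum_cons, Nat.cast_add, add_mul,
      Finset.sum_add_distrib, ih]
    rw [add_comm]
    congr 1
    rw [Finset.sum_eq_single r.1]
    · simp
    · intro i _ hi; simp [hi.symm]
    · simp

/-! ### Decomposition of the regret over the agents. -/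

section Network

variable {N d : ℕ} (G : SimpleGraph (Fin N)) [DecidableRel G.Adj]

theorem self_mem_nbhd (j : Fin N) : j ∈ nbhd G j := by simp [nbhd]

instance (j : Fin N) : Nonempty (nbhd G j) := ⟨⟨j, self_mem_nbhd G j⟩⟩

theorem taskVariance_eq_localVariance (U : Fin N → E d) (j : Fin N) :
    taskVariance (fun i : nbhd G j => U i) = localVariance G U j := by
  rw [taskVariance_eq_sum, localVariance, Fintype.card_coe]
  congr 1
  rw [← Finset.sum_coe_sort (nbhd G j)]
  refine Finset.sum_congr rfl fun i _ => ?_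
  exact Finset.sum_coe_sort (nbhd G j) fun k => ‖U i - U k‖ ^ 2

theorem localVariance_nonneg (U : Fin N → E d) (j : Fin N) : 0 ≤ localVariance G U j := by
  rw [← taskVariance_eq_localVariance]; exact taskVariance_nonneg _

theorem localVariance_const (u : E d) (j : Fin N) : localVariance G (fun _ => u) j = 0 := by
  simp [localVariance]

/-- The learning rates of the second phase, given the local history of the first phase. -/
noncomputable def phaseRate (w : Fin N → Fin N → ℝ) (τ : ℕ) {j : Fin N}
    (L : List (nbhd G j × E d)) (n : ℕ) : ℝ :=
  √(∑ i : nbhd G j, empiricalFreq G τ L i * w i j ^ 2) * √(1 + (n : ℝ))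

/-- The model of an agent as a function of its local history. -/
noncomputable def localModel (capTop : Prop) (w : Fin N → Fin N → ℝ) (τ : ℕ) (j : Fin N)
    (L : List (nbhd G j × E d)) : nbhd G j → E d :=
  if L.length < τ then 0 else mtFtrl capTop (phaseRate G w τ L) (L.drop τ)

theorem agentModel_eq (capTop : Prop) (w : Fin N → Fin N → ℝ) (τ : ℕ) (j : Fin N)
    (H : List (Fin N × E d)) :
    agentModel G capTop w τ j H = localModel G capTop w τ j (localHistory G w j H) := rfl

theorem map_fst_localHistory (w : Fin N → Fin N → ℝ) (j : Fin N) (H : List (Fin N × E d)) :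
    (localHistory G w j H).map (fun r => (r.1 : Fin N)) = visits (nbhd G j) (H.map Prod.fst) := by
  unfold localHistory visits
  induction H with
  | nil => rfl
  | cons r H ih =>
    by_cases h : r.1 ∈ nbhd G j
    · simp [h, ih]
    · simp [h, ih]

theorem norm_le_of_mem_localHistory {w : Fin N → Fin N → ℝ}
    (hw : ∀ i, ∀ j ∈ nbhd G i, 0 ≤ w i j) {j : Fin N} {H : List (Fin N × E d)}
    (hH : ∀ r ∈ H, ‖r.2‖ ≤ 1) {r : nbhd G j × E d} (hr : r ∈ localHistory G w j H) :
    ‖r.2‖ ≤ w r.1 j := by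
  obtain ⟨s, hs, h⟩ := List.mem_filterMap.1 hr
  by_cases hm : s.1 ∈ nbhd G j
  · rw [dif_pos hm] at h
    cases h
    rw [norm_smul, Real.norm_of_nonneg (hw _ _ (mem_nbhd_symm G hm))]
    exact mul_le_of_le_one_right (hw _ _ (mem_nbhd_symm G hm)) (hH s hs)
  · rw [dif_neg hm] at h
    cases h

/-- The linearized regret is the sum of the local regrets of the agents. -/
theorem pathSum_predict_eq (capTop : Prop) {w : Fin N → Fin N → ℝ}
    (hwsum : ∀ i, ∑ j ∈ nbhd G i, w i j = 1) (τ : ℕ) (U : Fin N → E d) (H : List (Fin N × E d)) :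
    pathSum (fun l r => inner ℝ r.2 (predict G capTop w τ l r.1 - U r.1)) H =
      ∑ j, pathSum (fun l r => inner ℝ r.2 (localModel G capTop w τ j l r.1 - U r.1))
        (localHistory G w j H) := by
  simp only [localHistory, pathSum_filterMap]
  rw [← pathSum_finset_sum]
  refine pathSum_congr fun l _ r _ => ?_
  -- The weights sum to one, so `U` can be distributed over the fetched models; each weight then
  -- moves onto the gradient sent to that neighbor.
  have h1 : predict G capTop w τ l r.1 - U r.1 = ∑ j : nbhd G r.1, w r.1 j •
      (agentModel G capTop w τ j l ⟨r.1, mem_nbhd_symm G j.2⟩ - U r.1) := by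
    have : ∑ j : nbhd G r.1, w r.1 j = 1 := by
      rw [Finset.sum_coe_sort (nbhd G r.1) fun j => w r.1 j, hwsum]
    simp only [smul_sub, Finset.sum_sub_distrib, ← Finset.sum_smul, this, one_smul]
    rfl
  rw [h1, inner_sum]
  have h2 : ∀ j : nbhd G r.1, inner ℝ r.2 (w r.1 j •
      (agentModel G capTop w τ j l ⟨r.1, mem_nbhd_symm G j.2⟩ - U r.1)) =
      (fun j : Fin N => ((if h : r.1 ∈ nbhd G j then
        some ((⟨r.1, h⟩ : nbhd G j), w r.1 j • r.2) else none).elim 0 fun b =>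
          (inner ℝ b.2 (localModel G capTop w τ j (localHistory G w j l) b.1 - U b.1) : ℝ))) j := by
    intro j
    simp only [dif_pos (mem_nbhd_symm G j.2), Option.elim_some]
    rw [inner_smul_right, inner_smul_left, agentModel_eq]
    rfl
  simp only [h2]
  rw [Finset.sum_coe_sort (nbhd G r.1) (fun j : Fin N => ((if h : r.1 ∈ nbhd G j then
        some ((⟨r.1, h⟩ : nbhd G j), w r.1 j • r.2) else none).elim 0 fun b =>
          (inner ℝ b.2 (localModel G capTop w τ j (localHistory G w j l) b.1 - U b.1) : ℝ)))]
  refine Finset.sum_subset (Finset.subset_univ _) fun j _ hj => ?_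
  rw [dif_neg fun h => hj (mem_nbhd_symm G h)]
  rfl

theorem sum_empiricalFreq_mul (τ : ℕ) {j : Fin N} (L : List (nbhd G j × E d)) (x : Fin N → ℝ) :
    ∑ i : nbhd G j, empiricalFreq G τ L i * x i =
      ((((L.map fun r => (r.1 : Fin N)).take τ).map x).sum) / τ := by
  have h := sum_countP_mul (fun i : nbhd G j => x i) (L.take τ)
  simp only [empiricalFreq, div_mul_eq_mul_div]
  rw [← Finset.sum_div, h, ← List.map_take, List.map_map]
  rfl

/-- The estimate is fixed by the first `τ` local rounds, so the second phase is one run of the base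
algorithm with a single rate sequence. -/
theorem phaseRate_congr (w : Fin N → Fin N → ℝ) {τ : ℕ} {j : Fin N}
    {L L' : List (nbhd G j × E d)} (h : L.take τ = L'.take τ) :
    phaseRate G w τ L = phaseRate G w τ L' := by
  funext n
  simp only [phaseRate, empiricalFreq, h]

/-- The local regret is at most `τ` plus the regret of `MT-FTRL` in the second phase. -/
theorem local_regret_le (capTop : Prop) (w : Fin N → Fin N → ℝ) (τ : ℕ) (j : Fin N)
    {U : Fin N → E d} (hU : ∀ i, ‖U i‖ ≤ 1) (L : List (nbhd G j × E d))
    (hL : ∀ r ∈ L, ‖r.2‖ ≤ 1) :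
    pathSum (fun l r => inner ℝ r.2 (localModel G capTop w τ j l r.1 - U r.1)) L ≤
      τ + pathSum (fun l (r : nbhd G j × E d) => inner ℝ r.2 (mtFtrl capTop (phaseRate G w τ L) l r.1 - U r.1))
        (L.drop τ) := by
  nth_rewrite 1 [← List.take_append_drop τ L]
  rw [pathSum_append]
  refine add_le_add ?_ ?_
  · have h1 : pathSum (fun l r => inner ℝ r.2 (localModel G capTop w τ j l r.1 - U r.1))
        (L.take τ) = pathSum (fun _ r => inner ℝ r.2 (-U r.1)) (L.take τ) := by
      refine pathSum_congr fun l hl r _ => ?_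
      have : l.length < τ := hl.trans_le (List.length_take_le _ _)
      simp [localModel, this]
    rw [h1]
    calc _ ≤ pathSum (fun _ _ => (1 : ℝ)) (L.take τ) := by
          refine pathSum_mono fun l r hr => (real_inner_le_norm _ _).trans ?_
          rw [norm_neg]
          exact mul_le_one₀ (hL r (List.mem_of_mem_take hr)) (norm_nonneg _) (hU _)
      _ ≤ τ := by
          rw [pathSum_eq_sum_map]
          simp
  · rcases lt_or_ge L.length τ with h | h
    · rw [List.drop_eq_nil_of_le h.le]; simp
    · have hlen : (L.take τ).length = τ := by simp [h]
      refine (pathSum_congr fun l _ r _ => ?_).le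
      have h1 : ¬(L.take τ ++ l).length < τ := by simp only [List.length_append, hlen]; omega
      have h2 : (L.take τ ++ l).drop τ = l := List.drop_left' hlen
      have h3 : (L.take τ ++ l).take τ = L.take τ := List.take_left' hlen
      rw [localModel, if_neg h1, h2, phaseRate_congr G w h3]

/-- A bound on the regret of the second phase in terms of the activations. -/
noncomputable def secondPhaseBound (S : Finset (Fin N)) (w : Fin N → ℝ) (V c : ℝ) (τ : ℕ)
    (a : List (Fin N)) : ℝ :=
  open Classical in
  if 0 < V ∧ τ * V / 4 ≤ (((visits S a).take τ).map fun i => w i ^ 2).sum ∧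
      (((visits S a).take τ).map fun i => w i ^ 2).sum ≤ 4 * (τ * V) then
    min (c * (2 * √V * √(((visits S a).drop τ).length : ℝ) + 2 / √V *
        pathSum (fun l i => w i ^ 2 / √(1 + (l.length : ℝ))) ((visits S a).drop τ)))
      (2 * (((visits S a).drop τ).map w).sum)
  else 2 * (((visits S a).drop τ).map w).sum

/-- When the empirical second moment is within a factor 4 of `V`, the rates are positive and
comparable to `√V * √(1 + n)`, and the clique regret bound applies. Otherwise the crude bound is
used. -/
theorem second_phase_le (capTop : Prop) {w : Fin N → Fin N → ℝ}
    (hw : ∀ i, ∀ j ∈ nbhd G i, 0 ≤ w i j) {τ : ℕ} (hτ : 0 < τ) (j : Fin N)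
    {U : Fin N → E d} (hU : ∀ i, ‖U i‖ ≤ 1) (hcap : capTop → localVariance G U j ≤ 1)
    {H : List (Fin N × E d)} (hH : ∀ r ∈ H, ‖r.2‖ ≤ 1) (V : ℝ) :
    pathSum (fun l (r : nbhd G j × E d) => inner ℝ r.2
        (mtFtrl capTop (phaseRate G w τ (localHistory G w j H)) l r.1 - U r.1))
      ((localHistory G w j H).drop τ) ≤
    secondPhaseBound (nbhd G j) (fun i => w i j) V
      (8 * √(Real.log (2 * N)) *
        √(1 + localVariance G U j * (((nbhd G j).card : ℝ) - 1))) τ (H.map Prod.fst) := by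
  set L := localHistory G w j H with hL
  have hvis : visits (nbhd G j) (H.map Prod.fst) = L.map fun r => (r.1 : Fin N) :=
    (map_fst_localHistory G w j H).symm
  have hnorm : ∀ r ∈ L.drop τ, ‖r.2‖ ≤ w r.1 j := fun r hr =>
    norm_le_of_mem_localHistory G hw hH (List.mem_of_mem_drop hr)
  have hcrude : pathSum (fun l (r : nbhd G j × E d) => inner ℝ r.2
        (mtFtrl capTop (phaseRate G w τ L) l r.1 - U r.1)) (L.drop τ) ≤
      2 * (((visits (nbhd G j) (H.map Prod.fst)).drop τ).map fun i => w i j).sum := by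
    refine (mtFtrl_regret_le_sum_norm capTop _ _ (U := fun i : nbhd G j => U i) fun i => hU i).trans ?_
    rw [pathSum_const_mul, hvis, ← List.map_drop, List.map_map]
    refine mul_le_mul_of_nonneg_left ?_ (by norm_num)
    rw [← pathSum_eq_sum_map]
    exact pathSum_mono fun l r hr => hnorm r hr
  unfold secondPhaseBound
  split_ifs with h
  swap
  · exact hcrude
  refine le_min ?_ hcrude
  obtain ⟨hV, hlo, hhi⟩ := h
  rw [hvis] at hlo hhi ⊢
  have hτ' : (0 : ℝ) < τ := by exact_mod_cast hτ
  set W := ∑ i : nbhd G j, empiricalFreq G τ L i * w i j ^ 2 with hW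
  have hWeq := sum_empiricalFreq_mul G τ L (fun i => w i j ^ 2)
  rw [← hW] at hWeq
  have hW1 : V / 4 ≤ W := by rw [hWeq, le_div_iff₀ hτ']; linarith
  have hW2 : W ≤ 4 * V := by rw [hWeq, div_le_iff₀ hτ']; linarith
  have hsV : 0 < √V := Real.sqrt_pos.2 hV
  have hW0 : 0 < W := by linarith
  have hsW : 0 < √W := Real.sqrt_pos.2 hW0
  have hsW2 : √W ≤ 2 * √V := by
    apply Real.sqrt_le_iff.2
    refine ⟨by positivity, ?_⟩
    rw [mul_pow, Real.sq_sqrt hV.le]; linarith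
  have hsW1 : √V / 2 ≤ √W := by
    apply Real.le_sqrt_of_sq_le
    rw [div_pow, Real.sq_sqrt hV.le]; linarith
  have hrate : ∀ n, phaseRate G w τ L n = √W * √(1 + (n : ℝ)) := fun n => rfl
  have hN : 0 < N := j.pos
  have hreg := mtFtrl_regret (capTop := capTop) (β := phaseRate G w τ L)
    (fun n => by rw [hrate]; positivity)
    (fun m n hmn => by
      rw [hrate, hrate]
      have : (m : ℝ) ≤ n := by exact_mod_cast hmn
      gcongr) (L.drop τ) (U := fun i : nbhd G j => U i) (fun i => hU i)
    (fun h => by rw [taskVariance_eq_localVariance]; exact hcap h)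
  rw [taskVariance_eq_localVariance, Fintype.card_coe] at hreg
  rw [← List.map_drop, pathSum_map, List.length_map]
  have hcard : ((nbhd G j).card : ℝ) ≤ N := by
    have := Finset.card_le_univ (nbhd G j)
    rw [Fintype.card_fin] at this
    exact_mod_cast this
  have hcard1 : (1 : ℝ) ≤ (nbhd G j).card := by
    exact_mod_cast Finset.card_pos.2 ⟨j, self_mem_nbhd G j⟩
  -- For a nonempty second phase the last rate involves `1 + (length - 1) = length`; the truncated
  -- subtraction would spoil this for an empty one.
  rcases (L.drop τ).eq_nil_or_concat with hnil | ⟨l0, r0, hcons⟩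
  · rw [hnil]; simp
  have hpos : 1 ≤ (L.drop τ).length := by rw [hcons]; simp
  refine hreg.trans (mul_le_mul ?_ (add_le_add ?_ ?_) ?_ (by positivity))
  · gcongr
  · rw [hrate]
    have : 1 + (((L.drop τ).length - 1 : ℕ) : ℝ) = ((L.drop τ).length : ℝ) := by
      rw [Nat.cast_sub hpos]; simp
    rw [this]
    gcongr
  · rw [← pathSum_const_mul]
    refine pathSum_mono fun l r hr => ?_
    rw [hrate, List.length_map]
    have h1 : ‖r.2‖ ^ 2 ≤ w r.1 j ^ 2 := by gcongr; exact hnorm r hr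
    have h2 : 0 < √(1 + (l.length : ℝ)) := Real.sqrt_pos.2 (by positivity)
    calc ‖r.2‖ ^ 2 / (√W * √(1 + (l.length : ℝ)))
        ≤ w r.1 j ^ 2 / (√V / 2 * √(1 + (l.length : ℝ))) := by gcongr
      _ = _ := by field_simp
  · refine add_nonneg (by rw [hrate]; positivity) (pathSum_nonneg fun l r _ => ?_)
    rw [hrate]; positivity

end Network

/-! ### From the probability space to finite averages. -/

section Expectation

variable {α Ω : Type*} [Fintype α] [MeasurableSpace α] [MeasurableSingletonClass α]
  [MeasurableSpace Ω] {μ : Measure Ω} [IsProbabilityMeasure μ] {T : ℕ} {act : Fin T → Ω → α}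

theorem integrable_comp_activations (hact : ∀ t, Measurable (act t)) (F : (Fin T → α) → ℝ) :
    Integrable (fun ω => F fun t => act t ω) μ :=
  have hA : Measurable fun ω t => act t ω := measurable_pi_lambda _ hact
  have : IsFiniteMeasure (μ.map fun ω t => act t ω) := inferInstance
  (Integrable.of_finite (μ := μ.map fun ω t => act t ω) (f := F)).comp_measurable hA

theorem integral_comp_activations {q : α → ℝ} (hact : ∀ t, Measurable (act t))
    (hindep : iIndepFun act μ) (hlaw : ∀ t i, μ.real {ω | act t ω = i} = q i)
    (F : (Fin T → α) → ℝ) :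
    ∫ ω, F (fun t => act t ω) ∂μ = ∑ a : Fin T → α, (∏ t, q (a t)) * F a := by
  have hA : Measurable fun ω t => act t ω := measurable_pi_lambda _ hact
  have h1 := integral_map (μ := μ) hA.aemeasurable
    (f := F) (Integrable.of_finite (μ := μ.map fun ω t => act t ω)).aestronglyMeasurable
  rw [← h1, integral_fintype Integrable.of_finite]
  refine Finset.sum_congr rfl fun a _ => ?_
  rw [smul_eq_mul, map_measureReal_apply hA (measurableSet_singleton a)]
  congr 1
  have h2 : (fun ω t => act t ω) ⁻¹' {a} = ⋂ t, act t ⁻¹' {a t} := by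
    ext ω; simp [funext_iff]
  rw [h2, Measure.real, hindep.meas_iInter fun t => ⟨{a t}, measurableSet_singleton _, rfl⟩,
    ENNReal.toReal_prod]
  exact Finset.prod_congr rfl fun t _ => hlaw t (a t)

theorem integral_activations_eq_avg {q : α → ℝ} (hact : ∀ t, Measurable (act t))
    (hindep : iIndepFun act μ) (hlaw : ∀ t i, μ.real {ω | act t ω = i} = q i)
    (f : List α → ℝ) :
    ∫ ω, f (List.ofFn fun t => act t ω) ∂μ = avg q T f := by
  rw [avg_eq_sum]
  exact integral_comp_activations hact hindep hlaw fun a => f (List.ofFn a)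

theorem integral_comp_activation {q : α → ℝ} (hact : ∀ t, Measurable (act t))
    (hlaw : ∀ t i, μ.real {ω | act t ω = i} = q i) (t : Fin T) (f : α → ℝ) :
    ∫ ω, f (act t ω) ∂μ = ∑ i, q i * f i := by
  have h1 := integral_map (μ := μ) (hact t).aemeasurable
    (f := f) (Integrable.of_finite (μ := μ.map (act t))).aestronglyMeasurable
  have : IsProbabilityMeasure (μ.map (act t)) := Measure.isProbabilityMeasure_map (hact t).aemeasurable
  rw [← h1, integral_fintype Integrable.of_finite]
  refine Finset.sum_congr rfl fun i _ => ?_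
  rw [smul_eq_mul, map_measureReal_apply (hact t) (measurableSet_singleton i), ← hlaw t i]
  rfl

end Expectation

/-! ### Expected regret against comparators allowed by the cap. -/

section Main

variable {N d T : ℕ} (G : SimpleGraph (Fin N)) [DecidableRel G.Adj]

theorem multitaskRegret_le (capTop : Prop) {w : Fin N → Fin N → ℝ}
    (hw : ∀ i, ∀ j ∈ nbhd G i, 0 ≤ w i j) (hwsum : ∀ i, ∑ j ∈ nbhd G i, w i j = 1)
    {τ : ℕ} (hτ : 0 < τ) (ℓ : Fin T → Fin N → E d → ℝ) (a : Fin T → Fin N) (g : Fin T → E d)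
    (hg : ∀ t, ‖g t‖ ≤ 1 ∧ IsSubgradientAt (ℓ t (a t)) (run G capTop w τ a g t) (g t))
    {U : Fin N → E d} (hU : ∀ i, ‖U i‖ ≤ 1) (hcap : capTop → ∀ j, localVariance G U j ≤ 1)
    (V : Fin N → ℝ) :
    multitaskRegret ℓ a (run G capTop w τ a g) U ≤ N * τ +
      ∑ j, secondPhaseBound (nbhd G j) (fun i => w i j) (V j)
        (8 * √(Real.log (2 * N)) *
          √(1 + localVariance G U j * (((nbhd G j).card : ℝ) - 1))) τ (List.ofFn a) := by
  set H := List.ofFn fun s => (a s, g s) with hH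
  have hfst : H.map Prod.fst = List.ofFn a := by
    rw [hH, List.map_ofFn]; rfl
  have hHn : ∀ r ∈ H, ‖r.2‖ ≤ 1 := fun r hr => by
    obtain ⟨s, rfl⟩ := (List.mem_ofFn' _ _).1 hr
    exact (hg s).1
  have h1 : multitaskRegret ℓ a (run G capTop w τ a g) U ≤
      pathSum (fun l r => inner ℝ r.2 (predict G capTop w τ l r.1 - U r.1)) H := by
    have e : pathSum (fun l r => inner ℝ r.2 (predict G capTop w τ l r.1 - U r.1)) H =
        ∑ t : Fin T, inner ℝ (g t) (run G capTop w τ a g t - U (a t)) := by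
      have hlen : T = H.length := (List.length_ofFn).symm
      unfold pathSum
      rw [← (finCongr hlen).sum_comp]
      refine Finset.sum_congr rfl fun t _ => ?_
      have hget : H.get (finCongr hlen t) = (a t, g t) := by simp [hH]
      rw [hget]
      rfl
    rw [e]
    refine Finset.sum_le_sum fun t _ => ?_
    have := (hg t).2 (U (a t)) (hU _)
    rw [← neg_sub (U (a t)), inner_neg_right]
    linarith
  refine h1.trans ?_
  rw [pathSum_predict_eq G capTop hwsum, ← hfst]
  calc _ ≤ ∑ j, ((τ : ℝ) + secondPhaseBound (nbhd G j) (fun i => w i j) (V j)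
        (8 * √(Real.log (2 * N)) *
          √(1 + localVariance G U j * (((nbhd G j).card : ℝ) - 1))) τ (H.map Prod.fst)) := by
        refine Finset.sum_le_sum fun j _ => (local_regret_le G capTop w τ j hU _ fun r hr => ?_).trans
          (add_le_add le_rfl (second_phase_le G capTop hw hτ j hU (fun h => hcap h j) hHn (V j)))
        -- Each weight is at most one, as the weights of an agent are nonnegative with sum one; so
        -- the gradients received have norm at most one.
        refine (norm_le_of_mem_localHistory G hw hHn hr).trans ?_
        rw [← hwsum r.1]
        exact Finset.single_le_sum (f := fun j => w r.1 j) (fun i hi => hw _ i hi)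
          (mem_nbhd_symm G r.1.2)
    _ = _ := by
        rw [Finset.sum_add_distrib]
        simp

/-- Only the degenerate case needs an extra argument: if the second moment is zero, all weights on
`S` vanish, since `q > 0`, and the crude bound is zero. -/
theorem avg_secondPhaseBound_le {q : Fin N → ℝ} (hq : ∀ i, 0 < q i) (hq1 : ∑ i, q i = 1)
    {S : Finset (Fin N)} (hS : S.Nonempty) {w : Fin N → ℝ} (hw : ∀ i ∈ S, 0 ≤ w i)
    {qm Λ c : ℝ} (hqm : 0 < qm) (hqm' : ∀ i, qm ≤ q i)
    (hΛ : 0 ≤ Λ) {τ : ℕ} (hτ : 4 * Λ ≤ τ * qm) (hT : 0 < T) (hTΛ : T * Real.exp (-Λ) ≤ 1 / 2)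
    (hc : 0 ≤ c) :
    avg q T (secondPhaseBound S w ((∑ i ∈ S, q i * w i ^ 2) / ∑ i ∈ S, q i) c τ) ≤
      (6 * c + 2) * (√(∑ i ∈ S, q i * w i ^ 2) * √(T : ℝ)) := by
  have hQ : 0 < ∑ i ∈ S, q i := Finset.sum_pos (fun i _ => hq i) hS
  have hx : ∀ i ∈ S, 0 ≤ q i * w i ^ 2 := fun i _ => mul_nonneg (hq i).le (sq_nonneg _)
  have hbad : ∀ l, secondPhaseBound S w ((∑ i ∈ S, q i * w i ^ 2) / ∑ i ∈ S, q i) c τ l ≤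
      2 * (((visits S l).drop τ).map w).sum := fun l => by
    unfold secondPhaseBound
    split_ifs
    · exact min_le_right _ _
    · exact le_rfl
  rcases (Finset.sum_nonneg hx).eq_or_lt with h0 | h0
  · have hw0 : ∀ i ∈ S, w i = 0 := fun i hi => by
      have := (Finset.sum_eq_zero_iff_of_nonneg hx).1 h0.symm i hi
      simpa [(hq i).ne'] using this
    rw [← h0]
    simp only [Real.sqrt_zero, zero_mul, mul_zero]
    rw [← h0] at hbad
    refine (avg_mono (g := fun _ => 0) (fun i => (hq i).le) T fun l => (hbad l).trans ?_).trans
      (avg_const hq1 T 0).le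
    have : ((visits S l).drop τ).map w = ((visits S l).drop τ).map fun _ => 0 :=
      List.map_congr_left fun i hi => hw0 i (mem_of_mem_visits (List.mem_of_mem_drop hi))
    rw [this]
    simp
  · have hV : 0 < (∑ i ∈ S, q i * w i ^ 2) / ∑ i ∈ S, q i := div_pos h0 hQ
    refine avg_second_phase_le hq hq1 hS hw hV (div_mul_cancel₀ _ hQ.ne') hqm hqm' hΛ hτ hT hTΛ hc
      (fun l _ h1 h2 => ?_) hbad
    unfold secondPhaseBound
    rw [if_pos ⟨hV, h1, h2⟩]
    exact min_le_left _ _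

theorem integral_regret_le (hT : 0 < T) {q : Fin N → ℝ} (hq : ∀ i, 0 < q i)
    (hqsum : ∑ i, q i = 1) {w : Fin N → Fin N → ℝ} (hw : ∀ i, ∀ j ∈ nbhd G i, 0 ≤ w i j)
    (hwsum : ∀ i, ∑ j ∈ nbhd G i, w i j = 1) (ℓ : Fin T → Fin N → E d → ℝ) (capTop : Prop)
    (g : (Fin T → Fin N) → Fin T → E d)
    (hg : ∀ a t, ‖g a t‖ ≤ 1 ∧
      IsSubgradientAt (ℓ t (a t)) (run G capTop w (burnIn q T) a (g a) t) (g a t))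
    {Ω : Type*} [MeasurableSpace Ω] (μ : Measure Ω) [IsProbabilityMeasure μ]
    (act : Fin T → Ω → Fin N) (hact : ∀ t, Measurable (act t)) (hindep : iIndepFun act μ)
    (hlaw : ∀ t i, μ.real {ω | act t ω = i} = q i)
    (U : Fin N → E d) (hU : ∀ i, ‖U i‖ ≤ 1) (hcap : capTop → ∀ j, localVariance G U j ≤ 1) :
    ∫ ω, multitaskRegret ℓ (fun t => act t ω)
        (run G capTop w (burnIn q T) (fun t => act t ω) (g fun t => act t ω)) U ∂μ ≤
      52 * (√(Real.log (2 * (N : ℝ))) *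
          (∑ j, √(∑ i ∈ nbhd G j, q i * w i j ^ 2) *
            √(1 + localVariance G U j * (((nbhd G j).card : ℝ) - 1))) * √(T : ℝ)
        + Real.log (2 * (N : ℝ) ^ 2 * (T : ℝ)) * ((N : ℝ) / ⨅ i, q i)) := by
  have hN : 0 < N := by
    rcases Nat.eq_zero_or_pos N with h | h
    · subst h; simp at hqsum
    · exact h
  have : Nonempty (Fin N) := ⟨⟨0, hN⟩⟩
  have hN1 : (1 : ℝ) ≤ N := by exact_mod_cast hN
  have hT1 : (1 : ℝ) ≤ T := by exact_mod_cast hT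
  set qm := ⨅ i, q i with hqm_def
  obtain ⟨i0, hi0⟩ := exists_eq_ciInf_of_finite (f := q)
  have hqm : 0 < qm := by rw [hqm_def, ← hi0]; exact hq i0
  have hqm' : ∀ i, qm ≤ q i := fun i => ciInf_le (Set.finite_range q).bddBelow i
  have hqm1 : qm ≤ 1 := (hqm' i0).trans (by
    rw [← hqsum]; exact Finset.single_le_sum (fun i _ => (hq i).le) (Finset.mem_univ i0))
  set Λ := Real.log (2 * (N : ℝ) ^ 2 * (T : ℝ)) with hΛ_def
  have hNT : 2 ≤ 2 * (N : ℝ) ^ 2 * (T : ℝ) := by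
    have : 1 ≤ (N : ℝ) ^ 2 * T := one_le_mul_of_one_le_of_one_le (one_le_pow₀ hN1) hT1
    linarith
  have hlog2 := Real.log_two_gt_d9
  have hΛ : 1 / 2 ≤ Λ := by
    have := Real.log_le_log (by norm_num) hNT
    norm_num at hlog2 ⊢
    linarith
  set τ := burnIn q T with hτ_def
  have hτ1 : 4 / qm * Λ ≤ τ := Nat.le_ceil _
  have hτ2 : (τ : ℝ) ≤ 4 / qm * Λ + 1 := (Nat.ceil_lt_add_one (by positivity)).le
  have hτ0 : 0 < τ := Nat.ceil_pos.2 (by positivity)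
  have hτ3 : 4 * Λ ≤ τ * qm := by
    rwa [div_mul_eq_mul_div, div_le_iff₀ hqm] at hτ1
  -- Here `exp (-Λ) = 1 / (2 * N ^ 2 * T)`.
  have hTΛ : T * Real.exp (-Λ) ≤ 1 / 2 := by
    rw [Real.exp_neg, hΛ_def, Real.exp_log (by linarith)]
    rw [← div_eq_mul_inv, div_le_iff₀ (by linarith)]
    nlinarith [one_le_pow₀ hN1 (n := 2)]
  set c : Fin N → ℝ := fun j => 8 * √(Real.log (2 * N)) *
          √(1 + localVariance G U j * (((nbhd G j).card : ℝ) - 1)) with hc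
  set V : Fin N → ℝ := fun j => (∑ i ∈ nbhd G j, q i * w i j ^ 2) / ∑ i ∈ nbhd G j, q i with hV
  have h1 := integral_mono (μ := μ)
    (integrable_comp_activations hact fun a => multitaskRegret ℓ a (run G capTop w τ a (g a)) U)
    (integrable_comp_activations hact fun a => N * τ + ∑ j, secondPhaseBound (nbhd G j)
      (fun i => w i j) (V j) (c j) τ (List.ofFn a))
    (fun ω => multitaskRegret_le G capTop hw hwsum hτ0 ℓ (fun t => act t ω) _ (hg _) hU hcap V)
  refine h1.trans ?_
  rw [integral_activations_eq_avg hact hindep hlaw (fun l => N * τ +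
    ∑ j, secondPhaseBound (nbhd G j) (fun i => w i j) (V j) (c j) τ l), avg_add, avg_const hqsum,
    avg_sum]
  have hl : 1 / 2 ≤ √(Real.log (2 * N)) := by
    apply Real.le_sqrt_of_sq_le
    have : Real.log 2 ≤ Real.log (2 * N) := Real.log_le_log (by norm_num) (by linarith)
    norm_num at hlog2 ⊢
    linarith
  set lg := √(Real.log (2 * N)) with hlg
  have h2 : ∀ j, avg q T (secondPhaseBound (nbhd G j) (fun i => w i j) (V j) (c j) τ) ≤
      52 * (lg * √(T : ℝ)) * (√(∑ i ∈ nbhd G j, q i * w i j ^ 2) *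
            √(1 + localVariance G U j * (((nbhd G j).card : ℝ) - 1))) := by
    intro j
    refine (avg_secondPhaseBound_le hq hqsum ⟨j, self_mem_nbhd G j⟩
      (fun i hi => hw i j (mem_nbhd_symm G hi)) hqm hqm' (by linarith) hτ3 hT hTΛ
      (by rw [hc]; positivity)).trans ?_
    have hcard1 : (1 : ℝ) ≤ (nbhd G j).card := by
      exact_mod_cast Finset.card_pos.2 ⟨j, self_mem_nbhd G j⟩
    have hK : 1 ≤ √(1 + localVariance G U j * (((nbhd G j).card : ℝ) - 1)) :=
      Real.one_le_sqrt.2 (by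
        have := localVariance_nonneg G U j
        nlinarith)
    rw [hc]
    simp only
    set K := √(1 + localVariance G U j * (((nbhd G j).card : ℝ) - 1))
    -- `lg ≥ 1 / 2` and `K ≥ 1` give `2 ≤ 4 * (lg * K)`, and `48 + 4 = 52`.
    have : 6 * (8 * lg * K) + 2 ≤ 52 * (lg * K) := by nlinarith
    calc _ ≤ 52 * (lg * K) * (√(∑ i ∈ nbhd G j, q i * w i j ^ 2) * √(T : ℝ)) := by gcongr
      _ = _ := by ring
  have h3 := Finset.sum_le_sum fun j (_ : j ∈ Finset.univ) => h2 j
  rw [← Finset.mul_sum] at h3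
  -- The 1 lost in the ceiling is at most `2 * (Λ / qm)`, because `Λ ≥ 1 / 2` and `qm ≤ 1`.
  have h4 : (τ : ℝ) ≤ 6 * (Λ / qm) := by
    have : 1 ≤ 2 * (Λ / qm) := by
      rw [← mul_div_assoc, le_div_iff₀ hqm]; linarith
    have e : 4 / qm * Λ = 4 * (Λ / qm) := by ring
    linarith
  have h5 : (N : ℝ) * τ ≤ 52 * (Λ * (N / qm)) := by
    have : Λ * (N / qm) = N * (Λ / qm) := by ring
    rw [this]
    have h6 : 0 ≤ Λ / qm := by positivity
    nlinarith
  refine (add_le_add h5 h3).trans (le_of_eq ?_)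
  ring

end Main
end MTCool

/-! ### The theorem, with the reduction to a constant comparator for common losses. -/

theorem mainTheorem7 :
    ∃ C : ℝ, 0 < C ∧
      ∀ (N d T : ℕ) (_hT : 0 < T)
        (G : SimpleGraph (Fin N)) [DecidableRel G.Adj]
        -- activation probabilities
        (q : Fin N → ℝ) (_hq : ∀ i, 0 < q i) (_hqsum : ∑ i, q i = 1)
        -- weights of the averages
        (w : Fin N → Fin N → ℝ) (_hw : ∀ i, ∀ j ∈ MTCool.nbhd G i, 0 ≤ w i j)
        (_hwsum : ∀ i, ∑ j ∈ MTCool.nbhd G i, w i j = 1)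
        -- convex losses on the unit ball, fixed in advance; `ℓ t i` is incurred at round `t` if
        -- agent `i` is active
        (ℓ : Fin T → Fin N → MTCool.E d → ℝ)
        (_hℓ : ∀ t i, ConvexOn ℝ (Metric.closedBall 0 1) (ℓ t i))
        -- is the top expert subject to its (otherwise dropped) variance constraint?
        (capTop : Prop)
        -- the observed subgradients, for each realization of the activations
        (g : (Fin T → Fin N) → Fin T → MTCool.E d)
        (_hg : ∀ a t, ‖g a t‖ ≤ 1 ∧
          MTCool.IsSubgradientAt (ℓ t (a t))
            (MTCool.run G capTop w (MTCool.burnIn q T) a (g a) t) (g a t))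
        -- independent activations with law `q`
        {Ω : Type*} [MeasurableSpace Ω] (μ : Measure Ω) [IsProbabilityMeasure μ]
        (act : Fin T → Ω → Fin N) (_hact : ∀ t, Measurable (act t))
        (_hindep : iIndepFun act μ)
        (_hlaw : ∀ t i, μ.real {ω | act t ω = i} = q i)
        -- the comparator
        (U : Fin N → MTCool.E d) (_hU : ∀ i, ‖U i‖ ≤ 1)
        -- if it is, then the losses do not depend on the agent, or the local variances are at most 1
        (_hcap : capTop →
          (∀ t i i', ℓ t i = ℓ t i') ∨ ∀ j, MTCool.localVariance G U j ≤ 1),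
        let R : Ω → ℝ := fun ω =>
          MTCool.multitaskRegret ℓ (fun t => act t ω)
            (MTCool.run G capTop w (MTCool.burnIn q T) (fun t => act t ω)
              (g fun t => act t ω)) U
        Integrable R μ ∧
        ∫ ω, R ω ∂μ ≤
          C * (√(Real.log (2 * (N : ℝ))) *
              (∑ j, √(∑ i ∈ MTCool.nbhd G j, q i * w i j ^ 2) *
                √(1 + MTCool.localVariance G U j * (((MTCool.nbhd G j).card : ℝ) - 1))) * √(T : ℝ)
            + Real.log (2 * (N : ℝ) ^ 2 * (T : ℝ)) * ((N : ℝ) / ⨅ i, q i)) := by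
  refine ⟨52, by norm_num, ?_⟩
  intro N d T hT G _ q hq hqsum w hw hwsum ℓ hℓ capTop g hg Ω _ μ _ act hact hindep hlaw U hU hcap R
  refine ⟨MTCool.integrable_comp_activations hact fun a => MTCool.multitaskRegret ℓ a
    (MTCool.run G capTop w (MTCool.burnIn q T) a (g a)) U, ?_⟩
  by_cases h : capTop → ∀ j, MTCool.localVariance G U j ≤ 1
  · exact MTCool.integral_regret_le G hT hq hqsum hw hwsum ℓ capTop g hg μ act hact hindep hlaw U
      hU h
  obtain ⟨hc, hvar⟩ := Classical.not_imp.1 h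
  have hsame := (hcap hc).resolve_right hvar
  -- The law of the active agent is the right weighting: the expected loss of `U` in a round is then
  -- the `q`-average that Jensen's inequality compares with the loss at `u`.
  set u : MTCool.E d := ∑ i, q i • U i with hu
  have hu1 : ‖u‖ ≤ 1 := by
    have := (convex_closedBall (0 : MTCool.E d) 1).sum_mem (t := Finset.univ)
      (fun i _ => (hq i).le) hqsum (fun i _ => mem_closedBall_zero_iff.2 (hU i))
    exact mem_closedBall_zero_iff.1 this
  have hmean := MTCool.integral_regret_le G hT hq hqsum hw hwsum ℓ capTop g hg μ act hact hindep
    hlaw (fun _ => u) (fun _ => hu1) (fun _ j => by rw [MTCool.localVariance_const]; norm_num)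
  have hsplit : ∀ ω, R ω = MTCool.multitaskRegret ℓ (fun t => act t ω)
      (MTCool.run G capTop w (MTCool.burnIn q T) (fun t => act t ω) (g fun t => act t ω))
        (fun _ => u) + ∑ t, (ℓ t (act t ω) u - ℓ t (act t ω) (U (act t ω))) := by
    intro ω
    simp only [R, MTCool.multitaskRegret]
    rw [← Finset.sum_add_distrib]
    exact Finset.sum_congr rfl fun t _ => by ring
  have hjensen : ∫ ω, ∑ t, (ℓ t (act t ω) u - ℓ t (act t ω) (U (act t ω))) ∂μ ≤ 0 := by
    rw [integral_finsetSum _ fun t _ => MTCool.integrable_comp_activations hact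
      fun a => ℓ t (a t) u - ℓ t (a t) (U (a t))]
    refine Finset.sum_nonpos fun t _ => ?_
    rw [MTCool.integral_comp_activation hact hlaw t fun i => ℓ t i u - ℓ t i (U i)]
    simp only [mul_sub]
    rw [Finset.sum_sub_distrib]
    rcases isEmpty_or_nonempty (Fin N) with hE | ⟨⟨i0⟩⟩
    · simp
    have e : ∀ i, ℓ t i = ℓ t i0 := fun i => hsame t i i0
    simp only [e]
    rw [← Finset.sum_mul, hqsum, one_mul]
    have := (hℓ t i0).map_sum_le (t := Finset.univ) (fun i _ => (hq i).le) hqsum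
      (fun i _ => mem_closedBall_zero_iff.2 (hU i))
    simp only [smul_eq_mul] at this
    linarith
  rw [integral_congr_ae (Filter.Eventually.of_forall hsplit), integral_add
    (MTCool.integrable_comp_activations hact fun a => MTCool.multitaskRegret ℓ a
      (MTCool.run G capTop w (MTCool.burnIn q T) a (g a)) fun _ => u)
    (MTCool.integrable_comp_activations hact fun a =>
      ∑ t, (ℓ t (a t) u - ℓ t (a t) (U (a t))))]
  refine (add_le_add hmean hjensen).trans ?_
  rw [add_zero]
  -- The bound for `u` has zero local variances, and the right-hand side increases with them.
  gcongr with j _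
  · have hq0 : 0 ≤ ((MTCool.nbhd G j).card : ℝ) - 1 := by
      have : (1 : ℝ) ≤ (MTCool.nbhd G j).card := by
        exact_mod_cast Finset.card_pos.2 ⟨j, MTCool.self_mem_nbhd G j⟩
      linarith
    exact hq0
  · rw [MTCool.localVariance_const]
    exact MTCool.localVariance_nonneg G U j
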